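/- Let $n\ge 3$, let $\mathbb{R}^n_+=\{y=(y_1,\dots,y_n)\in\mathbb{R}^n : y_n\ge 0\}$ with boundary $\partial\mathbb{R}^n_+=\{y_n=0\}$, and let $$U(y)=\bigl(y_1^2+\dots+y_{n-1}^2+(y_n+1)^2\bigr)^{-\frac{n-2}{2}},\qquad y\in\mathbb{R}^n_+ .$$ Set $J_j=\frac{\partial U}{\partial y_j}$ for $j=1,\dots,n-1$, and $J_n=\frac{n-2}{2}\,U+\sum_{b=1}^{n}y_b\frac{\partial U}{\partial y_b}$. Let $\psi:\mathbb{R}^n_+\to\mathbb{R}$ be a classical solution (that is, $C^2$ in the interior $\{y_n>0\}$ and $C^1$ up to the boundary) of $$\begin{cases}\Delta\psi=0 & \text{in } \{y_n>0\},\\[2pt] \dfrac{\partial\psi}{\partial y_n}+n\,U^{\frac{2}{n-2}}\,\psi=0 & \text{on } \partial\mathbb{R}^n_+ .\end{cases}$$ If there are constants $\alpha>0$ and $C$ such that $|\psi(y)|\le C(1+|y|)^{-\alpha}$ for all $y\in\mathbb{R}^n_+$, then there exist constants $c_1,\dots,c_n\in\mathbb{R}$ such that $$\psi(y)=\sum_{a=1}^{n}c_a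 J_a(y)\qquad\text{for all } y\in\mathbb{R}^n_+ .$$ -/

import Mathlib

open scoped BigOperators

namespace HalfSpace

/-- The Euclidean space of dimension `n = m + 1`. The last coordinate, `y (Fin.last m)`, is the
one written `y_n`; the coordinates `y j.castSucc`, `j : Fin m`, are `y_1, …, y_{n-1}`. -/
abbrev Space (m : ℕ) : Type := EuclideanSpace ℝ (Fin (m + 1))

/-- The coordinate vector `e_a`. -/
noncomputable def e (m : ℕ) (a : Fin (m + 1)) : Space m := EuclideanSpace.single a (1 : ℝ)

/-- The closed half-space `y_n ≥ 0`. -/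
def closedHalf (m : ℕ) : Set (Space m) := {y | 0 ≤ y (Fin.last m)}

/-- The open half-space `y_n > 0`. -/
def openHalf (m : ℕ) : Set (Space m) := {y | 0 < y (Fin.last m)}

/-- The boundary hyperplane `y_n = 0`. -/
def bdry (m : ℕ) : Set (Space m) := {y | y (Fin.last m) = 0}

/-- `U(y) = (y_1² + … + y_{n-1}² + (y_n + 1)²) ^ (-(n-2)/2)`, with `n = m + 1`. -/
noncomputable def U (m : ℕ) (y : Space m) : ℝ :=
  ((∑ j : Fin m, y j.castSucc ^ 2) + (y (Fin.last m) + 1) ^ 2) ^ (-((((m : ℝ) + 1) - 2) / 2))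

/-- The partial derivative `∂U/∂y_a`. The function `U` is smooth near the closed half-space. -/
noncomputable def partialU (m : ℕ) (a : Fin (m + 1)) (y : Space m) : ℝ :=
  fderiv ℝ (U m) y (e m a)

/-- `J_j = ∂U/∂y_j` for `1 ≤ j ≤ n-1`, and `J_n = (n-2)/2 · U + ∑_{b=1}^{n} y_b ∂U/∂y_b`,
with `n = m + 1`. -/
noncomputable def J (m : ℕ) (a : Fin (m + 1)) (y : Space m) : ℝ :=
  if a = Fin.last m then
    (((m : ℝ) + 1) - 2) / 2 * U m y + ∑ b : Fin (m + 1), y b * partialU m b y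
  else partialU m a y

/-- Classical solutions of the linearized problem: `ψ` is `C¹` up to the boundary, `C²` with
`Δψ = 0` in the open half-space, and `∂ψ/∂y_n + n U^{2/(n-2)} ψ = 0` on the boundary, with
`n = m + 1`; at a boundary point the derivative is the one of `ψ` restricted to the closed
half-space. Only the values of `ψ` on the closed half-space matter. -/
structure IsLinearizedSolution (m : ℕ) (ψ : Space m → ℝ) : Prop where
  contDiffOn : ContDiffOn ℝ 1 ψ (closedHalf m)
  harmonic : InnerProductSpace.HarmonicOnNhd ψ (openHalf m)
  boundary : ∀ y ∈ bdry m,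
    fderivWithin ℝ ψ (closedHalf m) y (e m (Fin.last m))
      + ((m : ℝ) + 1) * U m y ^ (2 / (((m : ℝ) + 1) - 2)) * ψ y = 0

end HalfSpace

/-! Write `X = 2 y_n y - (|y|² + 1) e_n`, a conformal field tangent to no boundary direction at `y_n
= 0`, and `Lψ = Xψ + (n-2) y_n ψ - nψ`, which is `defect ψ`. Since `X` is conformal, `L` maps
harmonic functions to harmonic functions. On `y_n = 0` one has `U^{2/(n-2)} = (|y|² + 1)⁻¹` and `X =
-(|y|² + 1) e_n`, so the boundary condition says exactly that `Lψ = 0` there. Formally `Lψ` is a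
harmonic function with zero Dirichlet data and, by the decay of `ψ`, sublinear growth; a Liouville
argument then gives `Lψ = 0`.

As `ψ` is only `C¹` up to the boundary, the Liouville argument is carried out weakly.
`integral_defect_mul_lap` shows that `Lψ` is orthogonal to `ΔZ` for test functions `Z` vanishing on
the boundary. Taking for `Z` the odd reflection of `(t - |y - x|²)₊^5` gives a mean value property:
the pairing of `Lψ` with the odd bump of exponent 4 and radius `s` equals `c s^{n+8}`
(`pairing_homogeneous`). Moving `L` onto the bump and using the decay of `ψ` shows that this pairing
is `o(s^{n+8})`, so `c = 0` (`pairing_eq_zero`); small `s` then forces `Lψ(x) = 0`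
(`defect_eq_zero`).

There remains a first-order equation along `X`. An inversion sends the half-space to the ball of
radius `1/2` about `e_n/2` and turns `X` into twice the radial field about the centre. The equation
says that the Kelvin transform of `ψ` is homogeneous of degree one about the centre; being
differentiable there, it is linear (`kelvin_eq_fderiv`). Pulled back, the `n` linear coordinates are
the `J_a` up to nonzero factors (`J_eq`). -/

namespace HalfSpace

/-! ### Coordinate calculus: commutators of the Laplacian with the Euler and conformal fields. -/

/-- The partial derivative `∂f/∂y_a`. -/
noncomputable def pd {m : ℕ} (a : Fin (m + 1)) (f : Space m → ℝ) (y : Space m) : ℝ :=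
  fderiv ℝ f y (e m a)

/-- The Laplacian in coordinates. -/
noncomputable def lap {m : ℕ} (f : Space m → ℝ) (y : Space m) : ℝ := ∑ a, pd a (pd a f) y

/-- The Euler operator `∑ y_a ∂f/∂y_a`. -/
noncomputable def euler {m : ℕ} (f : Space m → ℝ) (y : Space m) : ℝ := ∑ a, y a * pd a f y

/-- The squared norm in coordinates. -/
noncomputable def sqn {m : ℕ} (y : Space m) : ℝ := ∑ a, y a ^ 2

section calculus

variable {m : ℕ} {f g : Space m → ℝ} {a b : Fin (m + 1)} {y : Space m}

lemma e_apply (a b : Fin (m + 1)) : e m a b = if b = a then 1 else 0 := by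
  simp [e, PiLp.single_apply]

lemma sqn_eq_norm (y : Space m) : sqn y = ‖y‖ ^ 2 := by
  simp [sqn, EuclideanSpace.norm_sq_eq]

lemma differentiable_coord (b : Fin (m + 1)) : Differentiable ℝ (fun y : Space m => y b) :=
  (EuclideanSpace.proj (𝕜 := ℝ) b).differentiable

lemma contDiff_coord (b : Fin (m + 1)) {k : WithTop ℕ∞} :
    ContDiff ℝ k (fun y : Space m => y b) :=
  (EuclideanSpace.proj (𝕜 := ℝ) b).contDiff

lemma contDiff_sqn {k : WithTop ℕ∞} : ContDiff ℝ k (sqn (m := m)) := by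
  unfold sqn
  exact ContDiff.sum fun a _ => (contDiff_coord a).pow 2

lemma pd_coord (a b : Fin (m + 1)) (y : Space m) :
    pd a (fun y : Space m => y b) y = if b = a then 1 else 0 := by
  have : HasFDerivAt (fun y : Space m => y b) (EuclideanSpace.proj (𝕜 := ℝ) b) y :=
    (EuclideanSpace.proj (𝕜 := ℝ) b).hasFDerivAt
  rw [pd, this.fderiv]
  simp [e_apply]

lemma pd_const (c : ℝ) : pd a (fun _ : Space m => c) y = 0 := by simp [pd]

lemma pd_add (hf : DifferentiableAt ℝ f y) (hg : DifferentiableAt ℝ g y) :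
    pd a (fun y => f y + g y) y = pd a f y + pd a g y := by
  simp [pd, fderiv_fun_add hf hg]

lemma pd_sub (hf : DifferentiableAt ℝ f y) (hg : DifferentiableAt ℝ g y) :
    pd a (fun y => f y - g y) y = pd a f y - pd a g y := by
  simp [pd, fderiv_fun_sub hf hg]

lemma pd_mul (hf : DifferentiableAt ℝ f y) (hg : DifferentiableAt ℝ g y) :
    pd a (fun y => f y * g y) y = f y * pd a g y + g y * pd a f y := by
  simp [pd, fderiv_fun_mul hf hg]

lemma pd_const_mul (c : ℝ) (hf : DifferentiableAt ℝ f y) :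
    pd a (fun y => c * f y) y = c * pd a f y := by
  simp [pd, fderiv_const_mul hf]

lemma pd_sum {ι : Type*} (s : Finset ι) {F : ι → Space m → ℝ}
    (hF : ∀ i ∈ s, DifferentiableAt ℝ (F i) y) :
    pd a (fun y => ∑ i ∈ s, F i y) y = ∑ i ∈ s, pd a (F i) y := by
  simp [pd, fderiv_fun_sum hF]

lemma pd_sqn : pd a (sqn (m := m)) y = 2 * y a := by
  have : sqn (m := m) = fun y => ∑ b, y b * y b := by ext y; simp [sqn, sq]
  rw [this, pd_sum _ fun b _ => (differentiable_coord b y).fun_mul (differentiable_coord b y)]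
  simp only [pd_mul (differentiable_coord _ y) (differentiable_coord _ y), pd_coord]
  simp [two_mul, Finset.sum_add_distrib]

lemma contDiff_pd {k : ℕ} (hf : ContDiff ℝ (k + 1) f) : ContDiff ℝ k (pd a f) :=
  ((hf.fderiv_right (m := k) le_rfl).clm_apply contDiff_const)

lemma differentiable_pd (hf : ContDiff ℝ 2 f) : Differentiable ℝ (pd a f) :=
  (contDiff_pd (k := 1) (by exact_mod_cast hf)).differentiable (by simp)

lemma pd_pd (hf : DifferentiableAt ℝ (fderiv ℝ f) y) :
    pd a (pd b f) y = fderiv ℝ (fderiv ℝ f) y (e m a) (e m b) := by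
  have : HasFDerivAt (pd b f) _ y := hf.hasFDerivAt.clm_apply (hasFDerivAt_const (e m b) y)
  rw [pd, this.fderiv]
  simp

lemma pd_comm (hf : ContDiff ℝ 2 f) : pd a (pd b f) y = pd b (pd a f) y := by
  have h : DifferentiableAt ℝ (fderiv ℝ f) y :=
    (hf.fderiv_right (m := 1) (by norm_num)).differentiable (by simp) y
  rw [pd_pd h, pd_pd h]
  exact (hf.contDiffAt.isSymmSndFDerivAt (by simp)).eq _ _

lemma pd_comm' (hf : ContDiff ℝ 2 f) : pd a (pd b f) = pd b (pd a f) := by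
  ext y; exact pd_comm hf

lemma lap_add (hf : ContDiff ℝ 2 f) (hg : ContDiff ℝ 2 g) :
    lap (fun y => f y + g y) y = lap f y + lap g y := by
  have h1 := hf.differentiable (by simp)
  have h2 := hg.differentiable (by simp)
  have this (a : Fin (m + 1)) : pd a (fun y => f y + g y) = fun y => pd a f y + pd a g y := by
    ext y; exact pd_add (h1 y) (h2 y)
  simp only [lap, this, pd_add (differentiable_pd hf y) (differentiable_pd hg y),
    Finset.sum_add_distrib]

lemma lap_sub (hf : ContDiff ℝ 2 f) (hg : ContDiff ℝ 2 g) :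
    lap (fun y => f y - g y) y = lap f y - lap g y := by
  have h1 := hf.differentiable (by simp)
  have h2 := hg.differentiable (by simp)
  have this (a : Fin (m + 1)) : pd a (fun y => f y - g y) = fun y => pd a f y - pd a g y := by
    ext y; exact pd_sub (h1 y) (h2 y)
  simp only [lap, this, pd_sub (differentiable_pd hf y) (differentiable_pd hg y),
    Finset.sum_sub_distrib]

lemma lap_sum {ι : Type*} (s : Finset ι) {F : ι → Space m → ℝ}
    (hF : ∀ i ∈ s, ContDiff ℝ 2 (F i)) :
    lap (fun y => ∑ i ∈ s, F i y) y = ∑ i ∈ s, lap (F i) y := by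
  have this (a : Fin (m + 1)) : pd a (fun y => ∑ i ∈ s, F i y) = fun y => ∑ i ∈ s, pd a (F i) y := by
    ext y; exact pd_sum s fun i hi => (hF i hi).differentiable (by simp) y
  simp only [lap, this]
  rw [Finset.sum_comm]
  exact Finset.sum_congr rfl fun a _ => pd_sum s fun i hi => differentiable_pd (hF i hi) y

lemma lap_mul (hf : ContDiff ℝ 2 f) (hg : ContDiff ℝ 2 g) :
    lap (fun y => f y * g y) y
      = f y * lap g y + 2 * (∑ a, pd a f y * pd a g y) + g y * lap f y := by
  have h1 := hf.differentiable (by simp)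
  have h2 := hg.differentiable (by simp)
  have this (a : Fin (m + 1)) : pd a (fun y => f y * g y) = fun y => f y * pd a g y + g y * pd a f y := by
    ext y; exact pd_mul (h1 y) (h2 y)
  simp only [lap, this, Finset.mul_sum, ← Finset.sum_add_distrib]
  refine Finset.sum_congr rfl fun a _ => ?_
  have h3 := differentiable_pd (a := a) hf y
  have h4 := differentiable_pd (a := a) hg y
  rw [pd_add ((h1 y).fun_mul h4) ((h2 y).fun_mul h3), pd_mul (h1 y) h4, pd_mul (h2 y) h3]
  ring

lemma lap_const_mul (c : ℝ) (hf : ContDiff ℝ 2 f) :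
    lap (fun y => c * f y) y = c * lap f y := by
  rw [lap_mul contDiff_const hf]
  have this (a : Fin (m + 1)) : pd a (fun _ : Space m => c) = fun _ => 0 := by ext y; exact pd_const c
  simp [lap, this, pd_const]

lemma lap_coord_mul (hf : ContDiff ℝ 2 f) :
    lap (fun y => y b * f y) y = y b * lap f y + 2 * pd b f y := by
  rw [lap_mul (contDiff_coord b) hf]
  have this (a : Fin (m + 1)) : pd a (fun y : Space m => y b) = fun _ => if b = a then 1 else 0 := by
    ext y; exact pd_coord a b y
  simp [lap, this, pd_const]

lemma lap_sqn_mul (hf : ContDiff ℝ 2 f) :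
    lap (fun y => sqn y * f y) y
      = sqn y * lap f y + 4 * euler f y + 2 * (m + 1) * f y := by
  rw [lap_mul contDiff_sqn hf]
  have this (a : Fin (m + 1)) : pd a (sqn (m := m)) = fun y => 2 * y a := by ext y; exact pd_sqn
  have h2 : lap (sqn (m := m)) y = 2 * (m + 1) := by
    simp [lap, this, pd_const_mul _ (differentiable_coord _ y), pd_coord, mul_comm]
  have h3 : ∑ a, pd a (sqn (m := m)) y * pd a f y = 2 * euler f y := by
    simp [pd_sqn, euler, Finset.mul_sum, mul_assoc]
  rw [h2, h3]; ring

lemma contDiff_lap {k : ℕ} (hf : ContDiff ℝ (k + 2) f) : ContDiff ℝ k (lap f) := by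
  refine ContDiff.sum fun a _ => contDiff_pd (contDiff_pd (k := k + 1) ?_)
  convert hf using 1
  push_cast; rw [add_assoc]; norm_num

lemma contDiff_euler {k : ℕ} (hf : ContDiff ℝ (k + 1) f) : ContDiff ℝ k (euler f) :=
  ContDiff.sum fun a _ => (contDiff_coord a).mul (contDiff_pd hf)

lemma lap_pd (hf : ContDiff ℝ 3 f) : lap (pd a f) y = pd a (lap f) y := by
  have h2 (c) : ContDiff ℝ 2 (pd c f) := contDiff_pd (k := 2) (by norm_num; exact hf)
  unfold lap
  have := pd_sum (a := a) (y := y) Finset.univ (F := fun c => pd c (pd c f))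
    fun c _ => differentiable_pd (h2 c) y
  rw [this]
  refine Finset.sum_congr rfl fun c _ => ?_
  rw [pd_comm' (hf.of_le (by norm_num)), pd_comm (h2 c)]

lemma lap_euler (hf : ContDiff ℝ 3 f) :
    lap (euler f) y = euler (lap f) y + 2 * lap f y := by
  have h2 (c) : ContDiff ℝ 2 (pd c f) := contDiff_pd (k := 2) (by norm_num; exact hf)
  have : lap (euler f) y = ∑ c, lap (fun y => y c * pd c f y) y :=
    lap_sum Finset.univ (F := fun c y => y c * pd c f y) fun c _ => (contDiff_coord c).mul (h2 c)
  rw [this]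
  simp only [lap_coord_mul (h2 _), lap_pd hf, Finset.sum_add_distrib, euler]
  congr 1
  rw [← Finset.mul_sum]; rfl

lemma pd_euler (hf : ContDiff ℝ 2 f) :
    pd b (euler f) y = euler (pd b f) y + pd b f y := by
  have : pd b (euler f) y = ∑ c, pd b (fun y => y c * pd c f y) y :=
    pd_sum Finset.univ (F := fun c y => y c * pd c f y)
      fun c _ => (differentiable_coord c y).fun_mul (differentiable_pd hf y)
  rw [this]
  simp only [pd_mul (differentiable_coord _ y) (differentiable_pd hf y), pd_coord,
    Finset.sum_add_distrib, euler, pd_comm (b := b) hf]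
  simp

/-- The derivative along the conformal vector field `2 y_n y - (|y|² + 1) e_n`. -/
noncomputable def confDeriv (f : Space m → ℝ) (y : Space m) : ℝ :=
  2 * (y (Fin.last m) * euler f y) - (sqn y * pd (Fin.last m) f y + pd (Fin.last m) f y)

lemma contDiff_confDeriv {k : ℕ} (hf : ContDiff ℝ (k + 1) f) : ContDiff ℝ k (confDeriv f) :=
  (contDiff_const.mul ((contDiff_coord _).mul (contDiff_euler hf))).sub
    ((contDiff_sqn.mul (contDiff_pd hf)).add (contDiff_pd hf))

/-- Conformality of `X`, with `n = m + 1`. The last term is cancelled by `2(n-2) ∂_n f`, which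
arises from `Δ((n-2) y_n f)`; this is why `X + (n-2) y_n` preserves harmonicity. -/
lemma lap_confDeriv (hf : ContDiff ℝ 3 f) :
    lap (confDeriv f) y = confDeriv (lap f) y + 4 * (y (Fin.last m) * lap f y)
      + (4 - 2 * (m + 1)) * pd (Fin.last m) f y := by
  have hE : ContDiff ℝ 2 (euler f) := contDiff_euler (k := 2) (by norm_num; exact hf)
  have h2 : ContDiff ℝ 2 (pd (Fin.last m) f) := contDiff_pd (k := 2) (by norm_num; exact hf)
  have h1 : ContDiff ℝ 2 (fun y : Space m => y (Fin.last m)) := contDiff_coord _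
  have h0 : ContDiff ℝ 2 (sqn (m := m)) := contDiff_sqn
  unfold confDeriv
  rw [lap_sub (contDiff_const.mul (h1.mul hE)) ((h0.mul h2).add h2),
    lap_const_mul _ (h1.mul hE), lap_coord_mul hE, lap_add (h0.mul h2) h2, lap_sqn_mul h2,
    lap_euler hf, pd_euler (hf.of_le (by norm_num)), lap_pd hf]
  ring

/-- The dual multiplier: for `η = dualTest Z` one has
`Δη = -X(ΔZ) - (n+2) y_n ΔZ - n ΔZ`. -/
noncomputable def dualTest (f : Space m → ℝ) (y : Space m) : ℝ :=
  -1 * confDeriv f y - ((m - 1 : ℝ) * (y (Fin.last m) * f y) + (m + 1 : ℝ) * f y)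

lemma contDiff_dualTest {k : ℕ} (hf : ContDiff ℝ (k + 1) f) : ContDiff ℝ k (dualTest f) := by
  have hf' : ContDiff ℝ k f := hf.of_le (by exact_mod_cast Nat.le_succ k)
  exact (contDiff_const.mul (contDiff_confDeriv hf)).sub
    ((contDiff_const.mul ((contDiff_coord _).mul hf')).add (contDiff_const.mul hf'))

/-- The right side is the formal adjoint of `defect` applied to `lap f`, because `div X = 2n y_n`.
Hence the pairing of `defect ψ` with `lap f` reduces to that of `ψ` with a Laplacian. -/
lemma lap_dualTest (hf : ContDiff ℝ 3 f) :
    lap (dualTest f) y = -confDeriv (lap f) y - (m + 3) * (y (Fin.last m) * lap f y)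
      - (m + 1) * lap f y := by
  have hf2 : ContDiff ℝ 2 f := hf.of_le (by norm_num)
  have hX : ContDiff ℝ 2 (confDeriv f) := contDiff_confDeriv (k := 2) (by norm_num; exact hf)
  have h1 : ContDiff ℝ 2 (fun y : Space m => y (Fin.last m)) := contDiff_coord _
  unfold dualTest
  rw [lap_sub (contDiff_const.mul hX) ((contDiff_const.mul (h1.mul hf2)).add
    (contDiff_const.mul hf2)), lap_const_mul _ hX, lap_confDeriv hf,
    lap_add (contDiff_const.mul (h1.mul hf2)) (contDiff_const.mul hf2),
    lap_const_mul _ (h1.mul hf2), lap_const_mul _ hf2, lap_coord_mul hf2]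
  ring

/-- A function vanishing on the boundary hyperplane has vanishing tangential derivatives there. -/
lemma pd_eq_zero_of_bdry (hf : Differentiable ℝ f) (h0 : ∀ y ∈ bdry m, f y = 0)
    (ha : a ≠ Fin.last m) (hy : y ∈ bdry m) : pd a f y = 0 := by
  have h1 : HasDerivAt (fun t : ℝ => f (y + t • e m a)) (pd a f y) 0 := by
    have hl : HasDerivAt (fun t : ℝ => y + t • e m a) (e m a) 0 := by
      simpa using ((hasDerivAt_id (0 : ℝ)).smul_const (e m a)).const_add y
    have h2 : HasFDerivAt f (fderiv ℝ f y) (y + (0 : ℝ) • e m a) := by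
      simpa using (hf y).hasFDerivAt
    exact h2.comp_hasDerivAt 0 hl
  have h2 : (fun t : ℝ => f (y + t • e m a)) = fun _ => 0 := by
    ext t
    refine h0 _ ?_
    have : y (Fin.last m) = 0 := hy
    simp [bdry, this, e_apply, ha.symm]
  rw [h2] at h1
  exact h1.unique (hasDerivAt_const 0 (0 : ℝ))

lemma lap_bdry (hf : ContDiff ℝ 2 f) (h0 : ∀ y ∈ bdry m, f y = 0) (hy : y ∈ bdry m) :
    lap f y = pd (Fin.last m) (pd (Fin.last m) f) y := by
  refine Finset.sum_eq_single _ (fun a _ ha => ?_) (by simp)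
  exact pd_eq_zero_of_bdry (differentiable_pd hf)
    (fun z hz => pd_eq_zero_of_bdry (hf.differentiable (by simp)) h0 ha hz) ha hy

lemma euler_bdry (hf : Differentiable ℝ f) (h0 : ∀ y ∈ bdry m, f y = 0) (hy : y ∈ bdry m) :
    euler f y = 0 := by
  refine Finset.sum_eq_zero fun a _ => ?_
  by_cases ha : a = Fin.last m
  · have : y (Fin.last m) = 0 := hy
    simp [ha, this]
  · simp [pd_eq_zero_of_bdry hf h0 ha hy]

lemma dualTest_bdry (hf : Differentiable ℝ f) (h0 : ∀ y ∈ bdry m, f y = 0) (hy : y ∈ bdry m) :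
    dualTest f y = (sqn y + 1) * pd (Fin.last m) f y := by
  simp only [dualTest, confDeriv, euler_bdry hf h0 hy, h0 y hy]
  ring

lemma pd_dualTest_bdry (hf : ContDiff ℝ 2 f) (h0 : ∀ y ∈ bdry m, f y = 0) (hy : y ∈ bdry m) :
    pd (Fin.last m) (dualTest f) y
      = (sqn y + 1) * lap f y - (m + 1) * pd (Fin.last m) f y := by
  have hE : Differentiable ℝ (euler f) :=
    (contDiff_euler (k := 1) (by exact_mod_cast hf)).differentiable (by simp)
  have h2 : Differentiable ℝ (pd (Fin.last m) f) := differentiable_pd hf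
  have h1 : Differentiable ℝ (fun y : Space m => y (Fin.last m)) := differentiable_coord _
  have hs : Differentiable ℝ (sqn (m := m)) := (contDiff_sqn (k := 1)).differentiable (by simp)
  have hd := hf.differentiable (by simp)
  have hX : Differentiable ℝ (confDeriv f) :=
    (contDiff_confDeriv (k := 1) (by exact_mod_cast hf)).differentiable (by simp)
  have hc (c : ℝ) : DifferentiableAt ℝ (fun _ : Space m => c) y := differentiableAt_const c
  have hX' : pd (Fin.last m) (confDeriv f) y = -(sqn y + 1) * lap f y := by
    unfold confDeriv
    have hy0 : y (Fin.last m) = 0 := hy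
    rw [pd_sub ((hc 2).fun_mul ((h1 y).fun_mul (hE y))) (((hs y).fun_mul (h2 y)).fun_add (h2 y)),
      pd_const_mul _ ((h1 y).fun_mul (hE y)), pd_mul (h1 y) (hE y),
      pd_add ((hs y).fun_mul (h2 y)) (h2 y), pd_mul (hs y) (h2 y), pd_sqn, pd_coord,
      euler_bdry hd h0 hy, lap_bdry hf h0 hy, hy0]
    simp; ring
  have hy0 : y (Fin.last m) = 0 := hy
  unfold dualTest
  rw [pd_sub ((hc _).fun_mul (hX y)) (((hc _).fun_mul ((h1 y).fun_mul (hd y))).fun_add ((hc _).fun_mul (hd y))),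
    pd_const_mul _ (hX y), pd_add ((hc _).fun_mul ((h1 y).fun_mul (hd y))) ((hc _).fun_mul (hd y)),
    pd_const_mul _ ((h1 y).fun_mul (hd y)), pd_const_mul _ (hd y), pd_mul (h1 y) (hd y), hX',
    h0 y hy, hy0]
  ring

end calculus

end HalfSpace

/-! ### The divergence theorem on the half-space. -/

namespace HalfSpace

open MeasureTheory Set

section divergence

variable {m : ℕ}

lemma isOpen_openHalf : IsOpen (openHalf m) :=
  isOpen_lt continuous_const (differentiable_coord (Fin.last m)).continuous

lemma isClosed_closedHalf : IsClosed (closedHalf m) :=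
  isClosed_le continuous_const (differentiable_coord (Fin.last m)).continuous

lemma openHalf_subset : openHalf m ⊆ closedHalf m := fun y (h : 0 < y (Fin.last m)) => h.le

lemma measurableSet_openHalf : MeasurableSet (openHalf m) := isOpen_openHalf.measurableSet

lemma pd_eq_zero_of_norm_lt {f : Space m → ℝ} {R : ℝ} (hf : ∀ y, R ≤ ‖y‖ → f y = 0)
    {y : Space m} (hy : R < ‖y‖) (a : Fin (m + 1)) : pd a f y = 0 := by
  have : f =ᶠ[nhds y] fun _ => 0 := by
    filter_upwards [(isOpen_lt continuous_const continuous_norm).mem_nhds hy] with z hz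
    exact hf z (le_of_lt hz)
  rw [pd, this.fderiv_eq]; simp

/-- The divergence theorem on the half-space for compactly supported fields that are tangential
on the boundary. -/
theorem integral_div_eq_zero {V : Fin (m + 1) → Space m → ℝ} {R : ℝ}
    (hc : ∀ a, ContinuousOn (V a) (closedHalf m))
    (hd : ∀ a, ∀ y ∈ openHalf m, DifferentiableAt ℝ (V a) y)
    (hint : IntegrableOn (fun y => ∑ a, pd a (V a) y) (openHalf m))
    (hsupp : ∀ a y, R ≤ ‖y‖ → V a y = 0) (hb : ∀ y ∈ bdry m, V (Fin.last m) y = 0) :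
    ∫ y in openHalf m, ∑ a, pd a (V a) y = 0 := by
  set L := (EuclideanSpace.equiv (Fin (m + 1)) ℝ).symm with hL
  have hLa (x : Fin (m + 1) → ℝ) (i) : L x i = x i := rfl
  have hLc : Continuous L := L.continuous
  have hmp : MeasurePreserving L volume volume := PiLp.volume_preserving_toLp (Fin (m + 1))
  have hemb : MeasurableEmbedding L := L.toHomeomorph.measurableEmbedding
  set S : ℝ := max R 0 + 1
  have hS0 : 0 < S := by positivity
  have hRS : R < S := lt_of_le_of_lt (le_max_left _ _) (lt_add_one _)
  -- The box has one face in the boundary hyperplane, where the normal component vanishes; all other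
  -- faces lie outside the support.
  set lo : Fin (m + 1) → ℝ := fun i => if i = Fin.last m then 0 else -S
  set hi : Fin (m + 1) → ℝ := fun _ => S
  have hle : lo ≤ hi := by
    intro i; simp only [lo, hi]; split_ifs <;> linarith
  set D : Space m → ℝ := fun y => ∑ a, pd a (V a) y with hD
  have hnorm (x : Fin (m + 1) → ℝ) (i) : |x i| ≤ ‖L x‖ := PiLp.norm_apply_le (L x) i
  have hDz (x : Fin (m + 1) → ℝ) (i) (h : S ≤ |x i|) : D (L x) = 0 :=
    Finset.sum_eq_zero fun a _ => pd_eq_zero_of_norm_lt (hsupp a)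
      (hRS.trans_le (h.trans (hnorm x i))) a
  have hpre : L ⁻¹' (openHalf m) = {x | 0 < x (Fin.last m)} := rfl
  have hsub : (Set.pi univ fun i => Ioo (lo i) (hi i)) ⊆ {x | 0 < x (Fin.last m)} := by
    intro x hx
    have := (hx (Fin.last m) (mem_univ _)).1
    simpa [lo] using this
  have hcl {x} (hx : x ∈ Icc lo hi) : L x ∈ closedHalf m := by
    have := hx.1 (Fin.last m)
    simpa [lo, closedHalf, hLa] using this
  have hae : (Set.pi univ fun i => Ioo (lo i) (hi i)) =ᵐ[volume] Icc lo hi :=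
    Measure.univ_pi_Ioo_ae_eq_Icc
  have hbox : ∫ y in openHalf m, D y = ∫ x in Icc lo hi, D (L x) := by
    rw [← hmp.setIntegral_preimage_emb hemb, hpre,
      ← setIntegral_congr_set hae]
    refine setIntegral_eq_of_subset_of_forall_sdiff_eq_zero
      (measurableSet_lt measurable_const (measurable_pi_apply _)) hsub ?_
    rintro x ⟨hx, hx'⟩
    simp only [Set.mem_pi, not_forall] at hx'
    obtain ⟨i, -, hi'⟩ := hx'
    refine hDz x i ?_
    by_contra! hlt
    refine hi' ⟨?_, (abs_lt.1 hlt).2⟩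
    simp only [lo]
    split_ifs with h
    · rw [h]; exact hx
    · exact (abs_lt.1 hlt).1
  have hI : IntegrableOn (fun x => D (L x)) (Icc lo hi) := by
    have := (hmp.integrableOn_comp_preimage hemb (f := D) (s := openHalf m)).2 hint
    rw [hpre] at this
    exact (this.mono_set hsub).congr_set_ae hae.symm
  have hf' (a) (x : Fin (m + 1) → ℝ) :
      (fderiv ℝ (V a) (L x) ∘L (L : (Fin (m + 1) → ℝ) →L[ℝ] Space m)) (Pi.single a 1)
        = pd a (V a) (L x) := rfl
  have key := integral_divergence_of_hasFDerivAt_off_countable' lo hi hle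
    (fun a x => V a (L x))
    (fun a x => fderiv ℝ (V a) (L x) ∘L (L : (Fin (m + 1) → ℝ) →L[ℝ] Space m)) ∅
    Set.countable_empty
    (fun a => (hc a).comp hLc.continuousOn fun x hx => hcl hx)
    (fun x hx a => ((hd a (L x) (hsub hx.1)).hasFDerivAt).comp x L.hasFDerivAt)
    (by simpa only [hf'] using hI)
  simp only [hf'] at key
  rw [hbox]
  refine key.trans (Finset.sum_eq_zero fun i _ => ?_)
  have hz (c : ℝ) (x : Fin m → ℝ) (h : S ≤ |c|) : V i (L (i.insertNth c x)) = 0 := by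
    refine hsupp i _ (hRS.le.trans (h.trans ?_))
    simpa using hnorm (i.insertNth c x) i
  have h1 (x : Fin m → ℝ) : V i (L (i.insertNth (hi i) x)) = 0 := hz _ x (le_abs_self _)
  have h2 (x : Fin m → ℝ) : V i (L (i.insertNth (lo i) x)) = 0 := by
    by_cases h : i = Fin.last m
    · subst h
      refine hb _ ?_
      change Fin.insertNth (α := fun _ => ℝ) (Fin.last m) (lo (Fin.last m)) x (Fin.last m) = 0
      rw [Fin.insertNth_apply_same]; simp [lo]
    · refine hz _ x ?_
      simp [lo, h, abs_of_pos hS0]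
  simp [h1, h2]

end divergence

end HalfSpace

/-! ### The first-order operator `defect` and its weak harmonicity. -/

namespace HalfSpace

open MeasureTheory Set

section weak

variable {m : ℕ}

/-- The components of the conformal vector field `2 y_n y - (|y|² + 1) e_n`. -/
noncomputable def confField (a : Fin (m + 1)) (y : Space m) : ℝ :=
  2 * (y (Fin.last m) * y a) - (if a = Fin.last m then 1 else 0) * (sqn y + 1)

/-- The partial derivatives of a function on the closed half-space. -/
noncomputable def pdWithin (a : Fin (m + 1)) (f : Space m → ℝ) (y : Space m) : ℝ :=
  fderivWithin ℝ f (closedHalf m) y (e m a)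

/-- The image of `ψ` under the first-order operator `X + (n-2) y_n - n`. -/
noncomputable def defect (ψ : Space m → ℝ) (y : Space m) : ℝ :=
  ∑ a, confField a y * pdWithin a ψ y
    + ((m - 1 : ℝ) * y (Fin.last m) - (m + 1)) * ψ y

lemma sum_confField_mul (c : Fin (m + 1) → ℝ) (y : Space m) :
    ∑ a, confField a y * c a
      = 2 * (y (Fin.last m) * ∑ a, y a * c a) - (sqn y + 1) * c (Fin.last m) := by
  simp only [confField, sub_mul, Finset.sum_sub_distrib, Finset.mul_sum]
  congr 1
  · exact Finset.sum_congr rfl fun a _ => by ring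
  · rw [Finset.sum_eq_single (Fin.last m)] <;> simp +contextual

lemma confDeriv_eq_sum (f : Space m → ℝ) (y : Space m) :
    confDeriv f y = ∑ a, confField a y * pd a f y := by
  rw [sum_confField_mul, confDeriv, euler]; ring

lemma contDiff_confField (a : Fin (m + 1)) {k : WithTop ℕ∞} :
    ContDiff ℝ k (confField a) :=
  (contDiff_const.mul ((contDiff_coord _).mul (contDiff_coord _))).sub
    (contDiff_const.mul (contDiff_sqn.add contDiff_const))

lemma differentiable_confField (a : Fin (m + 1)) : Differentiable ℝ (confField a) :=
  (contDiff_confField (k := 1) a).differentiable (by simp)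

lemma pd_confField (a : Fin (m + 1)) (y : Space m) :
    pd a (confField a) y = 2 * y (Fin.last m) := by
  have h1 := differentiable_coord (m := m)
  have hs : Differentiable ℝ (sqn (m := m)) := (contDiff_sqn (k := 1)).differentiable (by simp)
  have hc (c : ℝ) : DifferentiableAt ℝ (fun _ : Space m => c) y := differentiableAt_const c
  unfold confField
  rw [pd_sub ((hc _).fun_mul ((h1 _ y).fun_mul (h1 a y)))
      ((hc _).fun_mul ((hs y).fun_add (hc 1))),
    pd_const_mul _ ((h1 _ y).fun_mul (h1 a y)), pd_mul (h1 _ y) (h1 a y),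
    pd_const_mul _ ((hs y).fun_add (hc 1)), pd_add (hs y) (hc 1), pd_sqn, pd_const,
    pd_coord, pd_coord]
  by_cases h : a = Fin.last m
  · subst h; simp; ring
  · simp [h, Ne.symm h]

lemma uniqueDiffOn_closedHalf : UniqueDiffOn ℝ (closedHalf m) := by
  refine uniqueDiffOn_convex ?_ ?_
  · exact (convex_Ici (0 : ℝ)).linear_preimage
      ((EuclideanSpace.proj (𝕜 := ℝ) (Fin.last m)).toLinearMap)
  · refine ⟨e m (Fin.last m), interior_maximal openHalf_subset isOpen_openHalf ?_⟩
    simp [openHalf, e_apply]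

lemma closedHalf_mem_nhds {y : Space m} (hy : y ∈ openHalf m) : closedHalf m ∈ nhds y :=
  Filter.mem_of_superset (isOpen_openHalf.mem_nhds hy) openHalf_subset

lemma pdWithin_eq {f : Space m → ℝ} {y : Space m} (hy : y ∈ openHalf m) (a) :
    pdWithin a f y = pd a f y := by
  rw [pdWithin, fderivWithin_of_mem_nhds (closedHalf_mem_nhds hy), pd]

lemma pdWithin_eventuallyEq {f : Space m → ℝ} {y : Space m} (hy : y ∈ openHalf m) (a) :
    pdWithin a f =ᶠ[nhds y] pd a f := by
  filter_upwards [isOpen_openHalf.mem_nhds hy] with z hz using pdWithin_eq hz a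

lemma pd_congr {f g : Space m → ℝ} {y : Space m} (h : f =ᶠ[nhds y] g) (a) :
    pd a f y = pd a g y := by rw [pd, h.fderiv_eq, pd]

lemma lap_eq_laplacian {f : Space m → ℝ} {y : Space m} (hf : ContDiffAt ℝ 2 f y) :
    lap f y = Laplacian.laplacian f y := by
  rw [InnerProductSpace.laplacian_eq_iteratedFDeriv_orthonormalBasis f
    (EuclideanSpace.basisFun (Fin (m + 1)) ℝ)]
  refine Finset.sum_congr rfl fun a _ => ?_
  have h : DifferentiableAt ℝ (fderiv ℝ f) y :=
    (hf.fderiv_right (m := 1) (by norm_num)).differentiableAt (by simp)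
  rw [pd_pd h, iteratedFDeriv_two_apply]
  simp [e]

lemma integrableOn_openHalf {F : Space m → ℝ} {R : ℝ} (hF : ContinuousOn F (closedHalf m))
    (h0 : ∀ y, R ≤ ‖y‖ → F y = 0) : IntegrableOn F (openHalf m) := by
  have h1 : IntegrableOn F (closedHalf m ∩ Metric.closedBall 0 R) :=
    (hF.mono inter_subset_left).integrableOn_compact
      ((isCompact_closedBall (0 : Space m) R).inter_left isClosed_closedHalf)
  have h2 : IntegrableOn F (closedHalf m) := by
    refine h1.of_forall_sdiff_eq_zero isClosed_closedHalf.measurableSet ?_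
    rintro y ⟨hy, hy'⟩
    refine h0 y ?_
    by_contra! h
    exact hy' ⟨hy, by simpa using h.le⟩
  exact h2.mono_set openHalf_subset

/-- The power `2/(n-2)` undoes the exponent `-(n-2)/2` of `U` up to sign; this needs `n ≠ 2`. -/
lemma U_rpow_bdry (hm : 2 ≤ m) {y : Space m} (hy : y ∈ bdry m) :
    U m y ^ (2 / (((m : ℝ) + 1) - 2)) = (sqn y + 1)⁻¹ := by
  have hy0 : y (Fin.last m) = 0 := hy
  have hm' : ((m : ℝ) + 1) - 2 ≠ 0 := by
    have : (2 : ℝ) ≤ m := by exact_mod_cast hm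
    linarith
  have hs : (∑ j : Fin m, y j.castSucc ^ 2) + (y (Fin.last m) + 1) ^ 2 = sqn y + 1 := by
    simp [sqn, Fin.sum_univ_castSucc, hy0]
  have hpos : 0 ≤ sqn y + 1 := by rw [sqn_eq_norm]; positivity
  rw [U, hs, ← Real.rpow_mul hpos, ← Real.rpow_neg_one]
  congr 1
  field_simp

variable {ψ : Space m → ℝ}

/-- Equivalent to the vanishing of `defect ψ` on the boundary, where only the normal component of
`X` survives. -/
lemma IsLinearizedSolution.bdry_eq (hψ : IsLinearizedSolution m ψ) (hm : 2 ≤ m) {y : Space m} (hy : y ∈ bdry m) :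
    (sqn y + 1) * pdWithin (Fin.last m) ψ y = -(m + 1) * ψ y := by
  have h := hψ.boundary y hy
  rw [U_rpow_bdry hm hy] at h
  have hpos : sqn y + 1 ≠ 0 := by rw [sqn_eq_norm]; positivity
  rw [pdWithin]
  field_simp at h
  linarith

lemma IsLinearizedSolution.continuousOn_pdWithin (hψ : IsLinearizedSolution m ψ)
    (a : Fin (m + 1)) : ContinuousOn (pdWithin a ψ) (closedHalf m) :=
  (hψ.contDiffOn.continuousOn_fderivWithin uniqueDiffOn_closedHalf (by simp)).clm_apply
    continuousOn_const

lemma IsLinearizedSolution.continuousOn_defect (hψ : IsLinearizedSolution m ψ) :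
    ContinuousOn (defect ψ) (closedHalf m) := by
  have h1 : Continuous (fun y : Space m => y (Fin.last m)) := (differentiable_coord _).continuous
  refine (continuousOn_finsetSum _ fun a _ => ?_).add (ContinuousOn.mul ?_
    hψ.contDiffOn.continuousOn)
  · exact (differentiable_confField a).continuous.continuousOn.mul (hψ.continuousOn_pdWithin a)
  · exact ((continuous_const.mul h1).sub continuous_const).continuousOn

lemma IsLinearizedSolution.contDiffAt (hψ : IsLinearizedSolution m ψ) {y : Space m}
    (hy : y ∈ openHalf m) : ContDiffAt ℝ 2 ψ y := (hψ.harmonic y hy).1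

lemma IsLinearizedSolution.differentiableAt (hψ : IsLinearizedSolution m ψ) {y : Space m}
    (hy : y ∈ openHalf m) : DifferentiableAt ℝ ψ y :=
  (hψ.contDiffAt hy).differentiableAt (by simp)

lemma IsLinearizedSolution.differentiableAt_pdWithin (hψ : IsLinearizedSolution m ψ)
    {y : Space m} (hy : y ∈ openHalf m) (a : Fin (m + 1)) :
    DifferentiableAt ℝ (pdWithin a ψ) y := by
  have h : DifferentiableAt ℝ (pd a ψ) y :=
    (((hψ.contDiffAt hy).fderiv_right (m := 1) (by norm_num)).differentiableAt
      (by simp)).clm_apply (differentiableAt_const _)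
  exact h.congr_of_eventuallyEq (pdWithin_eventuallyEq hy a)

lemma IsLinearizedSolution.sum_pd_pdWithin (hψ : IsLinearizedSolution m ψ)
    {y : Space m} (hy : y ∈ openHalf m) : ∑ a, pd a (pdWithin a ψ) y = 0 := by
  have h := (hψ.harmonic y hy).2.eq_of_nhds
  rw [← lap_eq_laplacian (hψ.contDiffAt hy)] at h
  refine Eq.trans (Finset.sum_congr rfl fun a _ => ?_) h
  exact pd_congr (pdWithin_eventuallyEq hy a) a

/-- The divergence of `ψ g X`. -/
lemma IsLinearizedSolution.div_confField (hψ : IsLinearizedSolution m ψ) {g : Space m → ℝ}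
    (hg : Differentiable ℝ g) {y : Space m} (hy : y ∈ openHalf m) :
    ∑ a, pd a (fun y => ψ y * (g y * confField a y)) y
      = defect ψ y * g y - ψ y * (-confDeriv g y - (m + 3) * (y (Fin.last m) * g y)
        - (m + 1) * g y) := by
  have h (a : Fin (m + 1)) : pd a (fun y => ψ y * (g y * confField a y)) y
      = g y * (confField a y * pdWithin a ψ y) + ψ y * (confField a y * pd a g y)
        + ψ y * (g y * (2 * y (Fin.last m))) := by
    have hX := differentiable_confField a y
    rw [pd_mul (hψ.differentiableAt hy) ((hg y).fun_mul hX), pd_mul (hg y) hX, pd_confField,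
      pdWithin_eq hy]
    ring
  simp only [h, Finset.sum_add_distrib, ← Finset.mul_sum, ← confDeriv_eq_sum, defect]
  simp
  ring

lemma lap_eq_zero_of_norm_lt {f : Space m → ℝ} {R : ℝ} (hf : ∀ y, R ≤ ‖y‖ → f y = 0)
    {y : Space m} (hy : R + 1 ≤ ‖y‖) : lap f y = 0 := by
  refine Finset.sum_eq_zero fun a _ => pd_eq_zero_of_norm_lt (R := R + 1 / 2) (fun z hz => ?_)
    (by linarith) a
  exact pd_eq_zero_of_norm_lt hf (by linarith) a

lemma confDeriv_eq_zero_of_norm_lt {f : Space m → ℝ} {R : ℝ} (hf : ∀ y, R ≤ ‖y‖ → f y = 0)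
    {y : Space m} (hy : R < ‖y‖) : confDeriv f y = 0 := by
  rw [confDeriv_eq_sum]
  exact Finset.sum_eq_zero fun a _ => by rw [pd_eq_zero_of_norm_lt hf hy]; simp

lemma dualTest_eq_zero_of_norm_lt {f : Space m → ℝ} {R : ℝ} (hf : ∀ y, R ≤ ‖y‖ → f y = 0)
    {y : Space m} (hy : R < ‖y‖) : dualTest f y = 0 := by
  rw [dualTest, confDeriv_eq_zero_of_norm_lt hf hy, hf y hy.le]; simp

lemma confField_last_bdry {y : Space m} (hy : y ∈ bdry m) :
    confField (Fin.last m) y = -(sqn y + 1) := by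
  have hy0 : y (Fin.last m) = 0 := hy
  simp [confField, hy0]

/-- Integration by parts of the first-order operator against a test function vanishing on the
boundary. -/
theorem IsLinearizedSolution.integral_defect_mul (hψ : IsLinearizedSolution m ψ)
    {g : Space m → ℝ} (hg : ContDiff ℝ 1 g) {R : ℝ} (h0 : ∀ y, R ≤ ‖y‖ → g y = 0)
    (hb : ∀ y ∈ bdry m, g y = 0) :
    ∫ y in openHalf m, defect ψ y * g y
      = ∫ y in openHalf m, ψ y * (-confDeriv g y - (m + 3) * (y (Fin.last m) * g y)
        - (m + 1) * g y) := by
  have hgd : Differentiable ℝ g := hg.differentiable (by simp)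
  have hgc := hg.continuous
  have h1 : Continuous (fun y : Space m => y (Fin.last m)) := (differentiable_coord _).continuous
  have hX : Continuous (confDeriv g) :=
    (contDiff_confDeriv (k := 0) (by norm_num; exact hg)).continuous
  have hψc := hψ.contDiffOn.continuousOn
  have i1 : IntegrableOn (fun y => defect ψ y * g y) (openHalf m) :=
    integrableOn_openHalf (hψ.continuousOn_defect.mul hgc.continuousOn)
      fun y hy => by rw [h0 y hy, mul_zero]
  have i2 : IntegrableOn (fun y => ψ y * (-confDeriv g y - (m + 3) * (y (Fin.last m) * g y)
        - (m + 1) * g y)) (openHalf m) := by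
    refine integrableOn_openHalf (R := R + 1) (hψc.mul (Continuous.continuousOn ?_)) fun y hy => ?_
    · exact (hX.neg.sub (continuous_const.mul (h1.mul hgc))).sub (continuous_const.mul hgc)
    · rw [h0 y (by linarith), confDeriv_eq_zero_of_norm_lt h0 (by linarith)]; simp
  have hcong : EqOn (fun y => ∑ a, pd a (fun y => ψ y * (g y * confField a y)) y)
      (fun y => defect ψ y * g y - ψ y * (-confDeriv g y - (m + 3) * (y (Fin.last m) * g y)
        - (m + 1) * g y)) (openHalf m) := fun y hy => hψ.div_confField hgd hy
  have key := integral_div_eq_zero (V := fun a y => ψ y * (g y * confField a y)) (R := R)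
    (fun a => hψc.mul (hgc.mul (differentiable_confField a).continuous).continuousOn)
    (fun a y hy => (hψ.differentiableAt hy).mul ((hgd y).mul (differentiable_confField a y)))
    ((i1.sub i2).congr_fun hcong.symm measurableSet_openHalf)
    (fun a y hy => by simp [h0 y hy]) (fun y hy => by simp [hb y hy])
  rw [setIntegral_congr_fun measurableSet_openHalf hcong, integral_sub i1 i2] at key
  linarith

/-- The image of a solution under the first-order operator is orthogonal to Laplacians of test
functions vanishing on the boundary. -/
theorem IsLinearizedSolution.integral_defect_mul_lap (hψ : IsLinearizedSolution m ψ)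
    (hm : 2 ≤ m) {Z : Space m → ℝ} (hZ : ContDiff ℝ 3 Z) {R : ℝ}
    (h0 : ∀ y, R ≤ ‖y‖ → Z y = 0) (hb : ∀ y ∈ bdry m, Z y = 0) :
    ∫ y in openHalf m, defect ψ y * lap Z y = 0 := by
  have hZ2 : ContDiff ℝ 2 Z := hZ.of_le (by norm_num)
  have hZd : Differentiable ℝ Z := hZ.differentiable (by simp)
  have hg : ContDiff ℝ 1 (lap Z) := contDiff_lap (k := 1) (by norm_num; exact hZ)
  have hgd : Differentiable ℝ (lap Z) := hg.differentiable (by simp)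
  have hη : ContDiff ℝ 2 (dualTest Z) := contDiff_dualTest (k := 2) (by norm_num; exact hZ)
  have hηd : Differentiable ℝ (dualTest Z) := hη.differentiable (by simp)
  have hpη (a : Fin (m + 1)) : Differentiable ℝ (pd a (dualTest Z)) := differentiable_pd hη
  have hψc := hψ.contDiffOn.continuousOn
  have hlz (y : Space m) (hy : R + 1 ≤ ‖y‖) : lap Z y = 0 := lap_eq_zero_of_norm_lt h0 hy
  have hηz (y : Space m) (hy : R + 1 ≤ ‖y‖) : dualTest Z y = 0 :=
    dualTest_eq_zero_of_norm_lt h0 (by linarith)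
  have hpηz (a) (y : Space m) (hy : R + 1 ≤ ‖y‖) : pd a (dualTest Z) y = 0 :=
    pd_eq_zero_of_norm_lt (R := R + 1 / 2)
      (fun z hz => dualTest_eq_zero_of_norm_lt h0 (by linarith)) (by linarith) a
  have i1 : IntegrableOn (fun y => defect ψ y * lap Z y) (openHalf m) :=
    integrableOn_openHalf (hψ.continuousOn_defect.mul hg.continuous.continuousOn)
      fun y hy => by rw [hlz y hy, mul_zero]
  -- The field combines the flux of `X` with the Green flux of `ψ` and `dualTest Z`. Second
  -- derivatives of `ψ`, which need not be bounded near the boundary, enter its divergence only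
  -- through `Δψ = 0`; the divergence is therefore integrable.
  have hcong : EqOn (fun y => ∑ a, pd a (fun y => ψ y * (lap Z y * confField a y)
      + (ψ y * pd a (dualTest Z) y - dualTest Z y * pdWithin a ψ y)) y)
      (fun y => defect ψ y * lap Z y) (openHalf m) := by
    intro y hy
    have hψd := hψ.differentiableAt hy
    have hpd (a) := hψ.differentiableAt_pdWithin hy a
    have h (a : Fin (m + 1)) : pd a (fun y => ψ y * (lap Z y * confField a y)
        + (ψ y * pd a (dualTest Z) y - dualTest Z y * pdWithin a ψ y)) y
        = pd a (fun y => ψ y * (lap Z y * confField a y)) y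
          + (ψ y * pd a (pd a (dualTest Z)) y - dualTest Z y * pd a (pdWithin a ψ) y) := by
      rw [pd_add (hψd.fun_mul ((hgd y).fun_mul (differentiable_confField a y)))
          ((hψd.fun_mul (hpη a y)).fun_sub ((hηd y).fun_mul (hpd a))),
        pd_sub (hψd.fun_mul (hpη a y)) ((hηd y).fun_mul (hpd a)), pd_mul hψd (hpη a y),
        pd_mul (hηd y) (hpd a), pdWithin_eq hy]
      ring
    have hl : ∑ a, pd a (pd a (dualTest Z)) y = lap (dualTest Z) y := rfl
    simp only [h, Finset.sum_add_distrib, Finset.sum_sub_distrib, ← Finset.mul_sum,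
      hψ.sum_pd_pdWithin hy, hψ.div_confField hgd hy, hl, lap_dualTest hZ]
    ring
  have key := integral_div_eq_zero (V := fun a y => ψ y * (lap Z y * confField a y)
      + (ψ y * pd a (dualTest Z) y - dualTest Z y * pdWithin a ψ y)) (R := R + 1)
    (fun a => (hψc.mul (hg.continuous.mul
        (differentiable_confField a).continuous).continuousOn).add
      ((hψc.mul (hpη a).continuous.continuousOn).sub
        (hη.continuous.continuousOn.mul (hψ.continuousOn_pdWithin a))))
    (fun a y hy => by
      have hψd := hψ.differentiableAt hy
      exact (hψd.mul ((hgd y).mul (differentiable_confField a y))).add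
        ((hψd.mul (hpη a y)).sub ((hηd y).mul (hψ.differentiableAt_pdWithin hy a))))
    (i1.congr_fun hcong.symm measurableSet_openHalf)
    (fun a y hy => by simp [hlz y hy, hηz y hy, hpηz a y hy])
    -- The normal flux vanishes: the two `lap Z` terms cancel, and what is left is `∂_n Z` times the
    -- boundary condition.
    (fun y hy => by
      have h1 := hψ.bdry_eq hm hy
      rw [confField_last_bdry hy, dualTest_bdry hZd hb hy, pd_dualTest_bdry hZ2 hb hy]
      linear_combination (-pd (Fin.last m) Z y) * h1)
  rwa [setIntegral_congr_fun measurableSet_openHalf hcong] at key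

end weak
end HalfSpace

/-! ### Truncated powers. -/

namespace HalfSpace

open MeasureTheory Set

/-- The truncated power `max(0, s)^k`. -/
noncomputable def truncPow (k : ℕ) (s : ℝ) : ℝ := max 0 s ^ k

section truncPow

lemma truncPow_nonneg (k : ℕ) (s : ℝ) : 0 ≤ truncPow k s := pow_nonneg (le_max_left _ _) _

lemma truncPow_of_nonpos {k : ℕ} {s : ℝ} (hs : s ≤ 0) : truncPow (k + 1) s = 0 := by
  simp [truncPow, max_eq_left hs]

lemma truncPow_mono (k : ℕ) {s t : ℝ} (h : s ≤ t) : truncPow k s ≤ truncPow k t :=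
  pow_le_pow_left₀ (le_max_left _ _) (max_le_max le_rfl h) k

lemma mul_truncPow (k : ℕ) (s : ℝ) : s * truncPow (k + 1) s = truncPow (k + 2) s := by
  rcases le_total s 0 with h | h
  · rw [truncPow_of_nonpos h, truncPow_of_nonpos h, mul_zero]
  · simp only [truncPow, max_eq_right h]; ring

lemma continuous_truncPow (k : ℕ) : Continuous (truncPow k) :=
  (continuous_const.max continuous_id).pow k

lemma hasDerivAt_truncPow (k : ℕ) (s : ℝ) :
    HasDerivAt (truncPow (k + 2)) ((k + 2) * truncPow (k + 1) s) s := by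
  have hne : ∀ u : ℝ, u ≠ 0 →
      HasDerivAt (truncPow (k + 2)) ((k + 2) * truncPow (k + 1) u) u := by
    intro u hu
    rcases lt_or_gt_of_ne hu with h | h
    · rw [truncPow_of_nonpos h.le, mul_zero]
      refine (hasDerivAt_const u (0 : ℝ)).congr_of_eventuallyEq ?_
      filter_upwards [Iio_mem_nhds h] with v hv using truncPow_of_nonpos (le_of_lt hv)
    · have h1 := hasDerivAt_pow (k + 2) u
      have h2 : truncPow (k + 1) u = u ^ (k + 1) := by simp [truncPow, max_eq_right h.le]
      rw [h2]
      refine HasDerivAt.congr_of_eventuallyEq (f := fun v => v ^ (k + 2)) ?_ ?_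
      · simpa using h1
      · filter_upwards [Ioi_mem_nhds h] with v hv
        simp [truncPow, max_eq_right (le_of_lt (mem_Ioi.1 hv))]
  -- At the corner `s = 0` the derivative is obtained as the limit of the derivatives on both sides.
  rcases eq_or_ne s 0 with rfl | hs
  · exact hasDerivAt_of_hasDerivAt_of_ne (g := fun u => (k + 2) * truncPow (k + 1) u)
      (fun y hy => hne y hy) (continuous_truncPow _).continuousAt
      (continuous_const.mul (continuous_truncPow _)).continuousAt
  · exact hne s hs

lemma contDiff_truncPow (k : ℕ) : ContDiff ℝ k (truncPow (k + 1)) := by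
  induction k with
  | zero => exact contDiff_zero.2 (continuous_truncPow _)
  | succ k ih =>
    have hd : deriv (truncPow (k + 2)) = fun s => (k + 2) * truncPow (k + 1) s :=
      funext fun s => (hasDerivAt_truncPow k s).deriv
    push_cast
    refine contDiff_succ_iff_deriv.2 ⟨fun s => (hasDerivAt_truncPow k s).differentiableAt,
      by simp, ?_⟩
    rw [hd]
    exact contDiff_const.mul ih

lemma truncPow_sub_le (k : ℕ) {a b : ℝ} (h : b ≤ a) :
    truncPow (k + 1) a - truncPow (k + 1) b ≤ (k + 1) * truncPow k a * (a - b) := by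
  have hAB : max 0 b ≤ max 0 a := max_le_max le_rfl h
  have hB : 0 ≤ max 0 b := le_max_left _ _
  have hsub : max 0 a - max 0 b ≤ a - b := by
    rcases le_total a 0 with h1 | h1
    · rw [max_eq_left h1]; linarith
    · rw [max_eq_right h1]; linarith [le_max_right 0 b]
  have key (A B : ℝ) (hB : 0 ≤ B) (hAB : B ≤ A) :
      A ^ (k + 1) - B ^ (k + 1) ≤ (k + 1) * A ^ k * (A - B) := by
    induction k with
    | zero => simp
    | succ k ih =>
      have h1 : B ^ (k + 1) * (A - B) ≤ A ^ (k + 1) * (A - B) :=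
        mul_le_mul_of_nonneg_right (pow_le_pow_left₀ hB hAB _) (by linarith)
      have h2 := mul_le_mul_of_nonneg_left ih (hB.trans hAB)
      have e1 : A ^ (k + 1 + 1) - B ^ (k + 1 + 1)
        = A * (A ^ (k + 1) - B ^ (k + 1)) + B ^ (k + 1) * (A - B) := by ring
      have e2 : ((k + 1 : ℕ) + 1 : ℝ) * A ^ (k + 1) * (A - B)
        = A * ((k + 1) * A ^ k * (A - B)) + A ^ (k + 1) * (A - B) := by push_cast; ring
      rw [e1, e2]; linarith
  refine (key _ _ hB hAB).trans ?_
  have : 0 ≤ (k + 1) * truncPow k a := mul_nonneg (by positivity) (truncPow_nonneg _ _)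
  exact mul_le_mul_of_nonneg_left hsub this

end truncPow

/-! ### Radial bumps and their odd reflections. -/

section kernel

variable {m : ℕ}

/-- The bump `(t - |y - p|²)₊^k`. -/
noncomputable def bump (k : ℕ) (t : ℝ) (p y : Space m) : ℝ := truncPow k (t - sqn (y - p))

lemma contDiff_sqn_sub (p : Space m) {k : WithTop ℕ∞} :
    ContDiff ℝ k (fun y : Space m => sqn (y - p)) :=
  contDiff_sqn.comp (contDiff_id.sub contDiff_const)

lemma contDiff_bump (k : ℕ) (t : ℝ) (p : Space m) : ContDiff ℝ k (bump (k + 1) t p) :=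
  (contDiff_truncPow k).comp (contDiff_const.sub (contDiff_sqn_sub p))

lemma continuous_bump (k : ℕ) (t : ℝ) (p : Space m) : Continuous (bump k t p) :=
  (continuous_truncPow k).comp (continuous_const.sub (contDiff_sqn_sub p (k := 0)).continuous)

lemma sqn_nonneg (y : Space m) : 0 ≤ sqn y := by rw [sqn_eq_norm]; positivity

lemma bump_nonneg (k : ℕ) (t : ℝ) (p y : Space m) : 0 ≤ bump k t p y := truncPow_nonneg _ _

lemma bump_le (k : ℕ) {t : ℝ} (ht : 0 ≤ t) (p y : Space m) : bump k t p y ≤ t ^ k := by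
  have : truncPow k t = t ^ k := by simp [truncPow, ht]
  rw [← this]
  exact truncPow_mono k (by linarith [sqn_nonneg (y - p)])

lemma bump_eq_zero (k : ℕ) {s : ℝ} (hs : 0 ≤ s) {p y : Space m} (h : ‖p‖ + s ≤ ‖y‖) :
    bump (k + 1) (s ^ 2) p y = 0 := by
  refine truncPow_of_nonpos ?_
  rw [sqn_eq_norm]
  have h1 : s ≤ ‖y - p‖ := by linarith [norm_sub_norm_le y p]
  nlinarith

lemma pd_bump (k : ℕ) (t : ℝ) (p y : Space m) (a : Fin (m + 1)) :
    pd a (bump (k + 2) t p) y = -2 * (k + 2) * ((y a - p a) * bump (k + 1) t p y) := by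
  have h1 : HasFDerivAt (fun z : Space m => sqn (z - p)) (fderiv ℝ sqn (y - p)) y := by
    have h := ((contDiff_sqn (m := m) (k := 1)).differentiable (by simp) (y - p)).hasFDerivAt
    exact h.comp y ((hasFDerivAt_id y).sub_const p)
  have h2 := (hasDerivAt_truncPow k (t - sqn (y - p))).comp_hasFDerivAt y (h1.const_sub t)
  have h3 : fderiv ℝ sqn (y - p) (e m a) = 2 * (y - p) a := pd_sqn
  change fderiv ℝ (truncPow (k + 2) ∘ fun z => t - sqn (z - p)) y (e m a) = _
  rw [h2.fderiv]
  simp [h3, bump]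
  ring

/-- Two differentiations produce a factor `|y - p|²`. Writing it as `t - (t - |y - p|²)` leaves only
bumps of lower exponent with coefficients depending on `t`. -/
lemma lap_bump (k : ℕ) (t : ℝ) (p y : Space m) :
    lap (bump (k + 3) t p) y = (k + 3) * (4 * (k + 2) * (t * bump (k + 1) t p y)
      - (2 * (m + 1) + 4 * (k + 2)) * bump (k + 2) t p y) := by
  have h (a : Fin (m + 1)) : pd a (pd a (bump (k + 3) t p)) y
      = 4 * (k + 3) * (k + 2) * bump (k + 1) t p y * (y - p) a ^ 2
        - 2 * (k + 3) * bump (k + 2) t p y := by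
    have h1 : pd a (bump (k + 3) t p)
        = fun y => -2 * ((k + 1 : ℕ) + 2) * ((y a - p a) * bump (k + 2) t p y) := by
      ext z; exact pd_bump (k + 1) t p z a
    have h2 : DifferentiableAt ℝ (bump (k + 2) t p) y :=
      (contDiff_bump (k + 1) t p).differentiable (by simp) y
    have h3 : DifferentiableAt ℝ (fun y : Space m => y a - p a) y :=
      (differentiable_coord a y).sub_const _
    rw [h1, pd_const_mul _ (h3.fun_mul h2), pd_mul h3 h2, pd_bump,
      pd_sub (differentiable_coord a y) (differentiableAt_const _), pd_coord, pd_const]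
    push_cast
    simp
    ring
  have hs : ∑ a, (y - p) a ^ 2 = sqn (y - p) := rfl
  have hmul : (t - sqn (y - p)) * bump (k + 1) t p y = bump (k + 2) t p y := mul_truncPow k _
  simp only [lap, h, Finset.sum_sub_distrib, ← Finset.mul_sum, hs]
  simp
  linear_combination (-4 * (k + 3) * (k + 2)) * hmul

/-- The reflection in the boundary hyperplane. -/
noncomputable def refl (x : Space m) : Space m := x - (2 * x (Fin.last m)) • e m (Fin.last m)

lemma refl_apply (x : Space m) (a : Fin (m + 1)) :
    refl x a = x a - (if a = Fin.last m then 2 * x (Fin.last m) else 0) := by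
  simp [refl, e_apply]

lemma sqn_sub_refl (x y : Space m) :
    sqn (y - refl x) = sqn (y - x) + 4 * (x (Fin.last m) * y (Fin.last m)) := by
  simp only [sqn, Fin.sum_univ_castSucc]
  simp [refl_apply, Fin.castSucc_ne_last]
  ring

/-- The difference of the bumps at `x` and at its reflection. -/
noncomputable def oddBump (k : ℕ) (t : ℝ) (x y : Space m) : ℝ :=
  bump k t x y - bump k t (refl x) y

lemma continuous_oddBump (k : ℕ) (t : ℝ) (x : Space m) : Continuous (oddBump k t x) :=
  (continuous_bump k t x).sub (continuous_bump k t _)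

lemma contDiff_oddBump (k : ℕ) (t : ℝ) (x : Space m) : ContDiff ℝ k (oddBump (k + 1) t x) :=
  (contDiff_bump k t x).sub (contDiff_bump k t _)

lemma oddBump_bdry (k : ℕ) (t : ℝ) (x : Space m) {y : Space m} (hy : y ∈ bdry m) :
    oddBump k t x y = 0 := by
  have hy0 : y (Fin.last m) = 0 := hy
  simp [oddBump, bump, sqn_sub_refl, hy0]

lemma oddBump_eq_zero (k : ℕ) {s : ℝ} (hs : 0 ≤ s) {x y : Space m}
    (h : ‖x‖ + ‖refl x‖ + s ≤ ‖y‖) : oddBump (k + 1) (s ^ 2) x y = 0 := by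
  rw [oddBump, bump_eq_zero k hs (by linarith [norm_nonneg (refl x)]),
    bump_eq_zero k hs (by linarith [norm_nonneg x]), sub_zero]

lemma lap_oddBump (k : ℕ) (t : ℝ) (x y : Space m) :
    lap (oddBump (k + 3) t x) y = (k + 3) * (4 * (k + 2) * (t * oddBump (k + 1) t x y)
      - (2 * (m + 1) + 4 * (k + 2)) * oddBump (k + 2) t x y) := by
  have h (p : Space m) : ContDiff ℝ 2 (bump (k + 3) t p) :=
    (contDiff_bump (k + 2) t p).of_le (by exact_mod_cast Nat.le_add_left 2 k)
  unfold oddBump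
  rw [lap_sub (h _) (h _), lap_bump, lap_bump]
  ring

lemma oddBump_nonneg (k : ℕ) (t : ℝ) {x y : Space m} (hx : x ∈ openHalf m)
    (hy : y ∈ openHalf m) : 0 ≤ oddBump k t x y := by
  refine sub_nonneg.2 (truncPow_mono k ?_)
  have hx0 : 0 < x (Fin.last m) := hx
  have hy0 : 0 < y (Fin.last m) := hy
  rw [sqn_sub_refl]
  nlinarith [mul_pos hx0 hy0]

/-- The two arguments of the truncated power differ by `4 x_n y_n`. For fixed `x` and `|y|` of order
`s = √t`, the reflection thus gains one power of `s` over a single bump, which the Liouville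
argument needs. -/
lemma oddBump_le (k : ℕ) {t : ℝ} (ht : 0 ≤ t) {x y : Space m} (hx : x ∈ openHalf m)
    (hy : y ∈ openHalf m) :
    oddBump (k + 1) t x y ≤ (k + 1) * t ^ k * (4 * (x (Fin.last m) * y (Fin.last m))) := by
  have hxy : 0 < x (Fin.last m) * y (Fin.last m) := mul_pos hx hy
  have h := truncPow_sub_le k (a := t - sqn (y - x)) (b := t - sqn (y - refl x))
    (by rw [sqn_sub_refl]; linarith)
  refine h.trans ?_
  have e1 : t - sqn (y - x) - (t - sqn (y - refl x))
    = 4 * (x (Fin.last m) * y (Fin.last m)) := by rw [sqn_sub_refl]; ring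
  rw [e1]
  have := bump_le k ht x y
  unfold bump at this
  gcongr

lemma confDeriv_oddBump (k : ℕ) (t : ℝ) (x y : Space m) :
    confDeriv (oddBump (k + 2) t x) y = -2 * (k + 2) *
      ((∑ a, confField a y * (y - x) a) * oddBump (k + 1) t x y
        - 2 * x (Fin.last m) * confField (Fin.last m) y * bump (k + 1) t (refl x) y) := by
  have hd (p : Space m) : DifferentiableAt ℝ (bump (k + 2) t p) y :=
    (contDiff_bump (k + 1) t p).differentiable (by simp) y
  have h (a) : pd a (oddBump (k + 2) t x) y = -2 * (k + 2) *
      ((y - x) a * oddBump (k + 1) t x y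
        - (if a = Fin.last m then 2 * x (Fin.last m) else 0) * bump (k + 1) t (refl x) y) := by
    have : pd a (oddBump (k + 2) t x) y
      = pd a (bump (k + 2) t x) y - pd a (bump (k + 2) t (refl x)) y := pd_sub (hd _) (hd _)
    rw [this, pd_bump, pd_bump, refl_apply, oddBump, PiLp.sub_apply]
    ring
  rw [confDeriv_eq_sum]
  have h2 : ∑ a, confField a y * (if a = Fin.last m then 2 * x (Fin.last m) else 0)
      = 2 * x (Fin.last m) * confField (Fin.last m) y := by
    simp [mul_comm]
  rw [← h2, Finset.sum_mul, Finset.sum_mul, ← Finset.sum_sub_distrib, Finset.mul_sum]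
  refine Finset.sum_congr rfl fun a _ => ?_
  rw [h]; ring

end kernel

end HalfSpace

/-! ### The Liouville argument: `defect ψ` vanishes. -/

namespace HalfSpace

open MeasureTheory Set Filter Topology
open scoped Pointwise

section vanishing

variable {m : ℕ} {ψ : Space m → ℝ}

/-- The pairing of the defect with the odd bump. -/
noncomputable def pairing (ψ : Space m → ℝ) (k : ℕ) (x : Space m) (t : ℝ) : ℝ :=
  ∫ y in openHalf m, defect ψ y * oddBump k t x y

lemma IsLinearizedSolution.integrableOn_oddBump (hψ : IsLinearizedSolution m ψ) (k : ℕ)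
    (x : Space m) {s : ℝ} (hs : 0 ≤ s) :
    IntegrableOn (fun y => defect ψ y * oddBump (k + 1) (s ^ 2) x y) (openHalf m) :=
  integrableOn_openHalf (R := ‖x‖ + ‖refl x‖ + s)
    (hψ.continuousOn_defect.mul (continuous_oddBump _ _ _).continuousOn)
    fun y hy => by rw [oddBump_eq_zero k hs hy, mul_zero]

/-- Weak harmonicity tested with the odd bump of exponent 5, whose Laplacian involves exponents 3
and 4 only. -/
lemma IsLinearizedSolution.pairing_relation (hψ : IsLinearizedSolution m ψ) (hm : 2 ≤ m)
    (x : Space m) {s : ℝ} (hs : 0 ≤ s) :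
    16 * (s ^ 2 * pairing ψ 3 x (s ^ 2)) = (2 * (m + 1) + 16) * pairing ψ 4 x (s ^ 2) := by
  have i3 := hψ.integrableOn_oddBump 2 x hs
  have i4 := hψ.integrableOn_oddBump 3 x hs
  have h := hψ.integral_defect_mul_lap hm (Z := oddBump 5 (s ^ 2) x)
    ((contDiff_oddBump 4 _ x).of_le (by norm_num)) (fun y hy => oddBump_eq_zero 4 hs hy)
    (fun y hy => oddBump_bdry 5 _ x hy)
  have e1 (y : Space m) : defect ψ y * lap (oddBump 5 (s ^ 2) x) y
      = (5 * 16 * s ^ 2) * (defect ψ y * oddBump 3 (s ^ 2) x y)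
        - (5 * (2 * (m + 1) + 16)) * (defect ψ y * oddBump 4 (s ^ 2) x y) := by
    rw [show oddBump 5 (s ^ 2) x = oddBump (2 + 3) (s ^ 2) x from rfl, lap_oddBump]
    push_cast
    ring
  simp only [e1] at h
  rw [integral_sub (i3.const_mul _) (i4.const_mul _), integral_const_mul,
    integral_const_mul] at h
  simp only [pairing]
  linarith

lemma IsLinearizedSolution.hasDerivAt_pairing (hψ : IsLinearizedSolution m ψ)
    (x : Space m) {s : ℝ} (hs : 0 < s) :
    HasDerivAt (pairing ψ 4 x) (4 * pairing ψ 3 x (s ^ 2)) (s ^ 2) := by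
  have hd (t : ℝ) (p y : Space m) :
      HasDerivAt (fun t => bump 4 t p y) (4 * bump 3 t p y) t := by
    have h := (hasDerivAt_truncPow 2 (t - sqn (y - p))).comp t
      ((hasDerivAt_id t).sub_const (sqn (y - p)))
    refine HasDerivAt.congr_deriv h ?_
    simp only [bump]; norm_num
  have hdd (t : ℝ) (y : Space m) : HasDerivAt (fun t => defect ψ y * oddBump 4 t x y)
      (4 * (defect ψ y * oddBump 3 t x y)) t := by
    refine HasDerivAt.congr_deriv (((hd t x y).sub (hd t (refl x) y)).const_mul (defect ψ y)) ?_
    simp only [oddBump]; ring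
  -- Bumps increase with `t`, so those at the larger radius `T` dominate all `t < T²`.
  set T : ℝ := s + 1
  have hT : 0 ≤ T := by positivity
  have hnhds : Iio (T ^ 2) ∈ 𝓝 (s ^ 2) := Iio_mem_nhds (by nlinarith)
  have hmeas (k : ℕ) (t : ℝ) : AEStronglyMeasurable (fun y => defect ψ y * oddBump k t x y)
      (volume.restrict (openHalf m)) :=
    ((hψ.continuousOn_defect.mono openHalf_subset).mul
      (continuous_oddBump _ _ _).continuousOn).aestronglyMeasurable measurableSet_openHalf
  have hbound : IntegrableOn (fun y => 4 * (|defect ψ y| *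
      (bump 3 (T ^ 2) x y + bump 3 (T ^ 2) (refl x) y))) (openHalf m) := by
    refine integrableOn_openHalf (R := ‖x‖ + ‖refl x‖ + T) ?_ fun y hy => ?_
    · exact continuousOn_const.mul (hψ.continuousOn_defect.abs.mul
        ((continuous_bump _ _ _).add (continuous_bump _ _ _)).continuousOn)
    · rw [bump_eq_zero 2 hT (by linarith [norm_nonneg (refl x)]),
        bump_eq_zero 2 hT (by linarith [norm_nonneg x])]
      simp
  have key := hasDerivAt_integral_of_dominated_loc_of_deriv_le hnhds
    (Eventually.of_forall fun t => hmeas 4 t) (hψ.integrableOn_oddBump 3 x hs.le)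
    ((hmeas 3 (s ^ 2)).const_mul 4) (F' := fun t y => 4 * (defect ψ y * oddBump 3 t x y))
    (Eventually.of_forall fun y t ht => ?_) hbound (Eventually.of_forall fun y t _ => hdd t y)
  · have := key.2
    rw [integral_const_mul] at this
    exact this
  · have hmono (p : Space m) : bump 3 t p y ≤ bump 3 (T ^ 2) p y :=
      truncPow_mono 3 (by have := le_of_lt (mem_Iio.1 ht); linarith)
    rw [norm_mul, norm_mul, Real.norm_eq_abs, Real.norm_eq_abs, Real.norm_eq_abs,
      abs_of_pos (by norm_num : (0 : ℝ) < 4)]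
    gcongr
    rw [oddBump]
    have h1 := bump_nonneg 3 t x y
    have h2 := bump_nonneg 3 t (refl x) y
    have h3 := hmono x
    have h4 := hmono (refl x)
    rw [abs_le]; constructor <;> linarith

/-- With `P = pairing ψ 4 x`, the relation and `P' = 4 pairing ψ 3 x` give the Euler equation `4 t
P' = (2n + 16) P`, so `P` is a multiple of `t^{(n+8)/2}`. The variable `s = √t` turns this into the
natural power `s^{m+9}`. -/
lemma IsLinearizedSolution.pairing_homogeneous (hψ : IsLinearizedSolution m ψ) (hm : 2 ≤ m)
    (x : Space m) : ∃ c : ℝ, ∀ s : ℝ, 0 < s → pairing ψ 4 x (s ^ 2) = c * s ^ (m + 9) := by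
  set q : ℝ → ℝ := fun s => pairing ψ 4 x (s ^ 2) / s ^ (m + 9) with hq
  have hder : ∀ s ∈ Ioi (0 : ℝ), HasDerivAt q 0 s := by
    intro s hs
    have hs0 : (0 : ℝ) < s := hs
    have h1 : HasDerivAt (fun s : ℝ => pairing ψ 4 x (s ^ 2))
        (4 * pairing ψ 3 x (s ^ 2) * (2 * s)) s := by
      have := HasDerivAt.comp s (h := fun s : ℝ => s ^ 2) (hψ.hasDerivAt_pairing x hs0)
        (hasDerivAt_pow 2 s)
      exact this.congr_deriv (by simp)
    have h2 := h1.div (hasDerivAt_pow (m + 9) s) (by positivity)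
    refine h2.congr_deriv ?_
    have h3 := hψ.pairing_relation hm x hs0.le
    rw [div_eq_zero_iff]; left
    have : s ^ (m + 9) = s * s ^ (m + 8) := by ring
    have e : m + 9 - 1 = m + 8 := rfl
    rw [e, this]
    push_cast
    linear_combination (s ^ (m + 8) / 2) * h3
  refine ⟨q 1, fun s hs => ?_⟩
  have hconst : q s = q 1 :=
    (convex_Ioi (0 : ℝ)).is_const_of_fderivWithin_eq_zero
      (fun u hu => (hder u hu).differentiableAt.differentiableWithinAt)
      (fun u hu => by
        rw [fderivWithin_of_mem_nhds (Ioi_mem_nhds hu)]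
        have := (hder u hu).hasFDerivAt.fderiv
        rw [this]; ext; simp) hs (mem_Ioi.2 one_pos)
  rw [← hconst, hq]
  field_simp

/-- The function paired with `ψ` after integrating by parts. -/
noncomputable def adjKernel (x : Space m) (t : ℝ) (y : Space m) : ℝ :=
  -confDeriv (oddBump 4 t x) y - (m + 3) * (y (Fin.last m) * oddBump 4 t x y)
    - (m + 1) * oddBump 4 t x y

lemma IsLinearizedSolution.pairing_eq (hψ : IsLinearizedSolution m ψ) (x : Space m) {s : ℝ}
    (hs : 0 ≤ s) :
    pairing ψ 4 x (s ^ 2) = ∫ y in openHalf m, ψ y * adjKernel x (s ^ 2) y :=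
  hψ.integral_defect_mul ((contDiff_oddBump 3 _ x).of_le (by norm_num))
    (fun _ hy => oddBump_eq_zero 3 hs hy) (fun _ hy => oddBump_bdry 4 _ x hy)

lemma adjKernel_eq_zero {x y : Space m} {s : ℝ} (hs : 0 ≤ s)
    (h : ‖x‖ + ‖refl x‖ + s < ‖y‖) : adjKernel x (s ^ 2) y = 0 := by
  rw [adjKernel, confDeriv_eq_zero_of_norm_lt (fun _ hy => oddBump_eq_zero 3 hs hy) h,
    oddBump_eq_zero 3 hs h.le]
  simp

lemma abs_coord_le (y : Space m) (a : Fin (m + 1)) : |y a| ≤ ‖y‖ := PiLp.norm_apply_le y a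

/-- The coefficient `X · (y - x)` is `O(s³)` and the odd bump of exponent 3 is `O(x_n s⁵)`. The
reflected centre adds a term `x_n |X_n|` times a bump, again `O(x_n s⁸)`. Only the order `s⁸`
matters; the constants are crude. -/
lemma abs_adjKernel_le {x y : Space m} (hx : x ∈ openHalf m) (hy : y ∈ openHalf m) {s : ℝ}
    (hs : 1 ≤ s) (hxs : ‖x‖ ≤ s) (hys : ‖y‖ ≤ 2 * s) :
    |adjKernel x (s ^ 2) y| ≤ (8000 + 200 * m) * x (Fin.last m) * s ^ 8 := by
  have hx0 : 0 < x (Fin.last m) := hx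
  have hy0 : 0 < y (Fin.last m) := hy
  set ξ := x (Fin.last m) with hξ
  have hyn : y (Fin.last m) ≤ 2 * s := (le_abs_self _).trans ((abs_coord_le y _).trans hys)
  have hs0 : 0 ≤ s := by linarith
  have hsq : sqn y ≤ 4 * s ^ 2 := by
    rw [sqn_eq_norm]; nlinarith [norm_nonneg y]
  have hsq0 := sqn_nonneg y
  have hs2 : 1 ≤ s ^ 2 := by nlinarith
  have hyx : ‖y - x‖ ≤ 3 * s := (norm_sub_le _ _).trans (by linarith)
  have h4 : oddBump 4 (s ^ 2) x y ≤ 32 * ξ * s ^ 7 := by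
    refine (oddBump_le 3 (by positivity) hx hy).trans ?_
    have : (((3 : ℕ) : ℝ) + 1) * (s ^ 2) ^ 3 * (4 * (ξ * y (Fin.last m)))
      = 16 * ξ * s ^ 6 * y (Fin.last m) := by push_cast; ring
    rw [this]
    calc 16 * ξ * s ^ 6 * y (Fin.last m) ≤ 16 * ξ * s ^ 6 * (2 * s) := by gcongr
      _ = 32 * ξ * s ^ 7 := by ring
  have h3 : oddBump 3 (s ^ 2) x y ≤ 24 * ξ * s ^ 5 := by
    refine (oddBump_le 2 (by positivity) hx hy).trans ?_
    have : (((2 : ℕ) : ℝ) + 1) * (s ^ 2) ^ 2 * (4 * (ξ * y (Fin.last m)))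
      = 12 * ξ * s ^ 4 * y (Fin.last m) := by push_cast; ring
    rw [this]
    calc 12 * ξ * s ^ 4 * y (Fin.last m) ≤ 12 * ξ * s ^ 4 * (2 * s) := by gcongr
      _ = 24 * ξ * s ^ 5 := by ring
  have p4 := oddBump_nonneg 4 (s ^ 2) hx hy
  have p3 := oddBump_nonneg 3 (s ^ 2) hx hy
  have hb3 : bump 3 (s ^ 2) (refl x) y ≤ s ^ 6 :=
    (bump_le 3 (by positivity) _ _).trans_eq (by ring)
  have pb3 := bump_nonneg 3 (s ^ 2) (refl x) y
  have hXn : |confField (Fin.last m) y| ≤ 13 * s ^ 2 := by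
    simp only [confField, if_true]
    have := mul_le_mul hyn hyn hy0.le (by positivity)
    rw [abs_le]; constructor <;> nlinarith [mul_pos hy0 hy0]
  have hinner : |∑ a, y a * (y - x) a| ≤ 2 * s * (3 * s) := by
    have h1 : ∑ a, y a * (y - x) a = inner ℝ (y - x) y := by
      simp [PiLp.inner_apply]
    rw [h1]
    refine (abs_real_inner_le_norm _ _).trans ?_
    rw [mul_comm]; gcongr
  have hXyx : |∑ a, confField a y * (y - x) a| ≤ 39 * s ^ 3 := by
    rw [sum_confField_mul]
    have h1 : |2 * (y (Fin.last m) * ∑ a, y a * (y - x) a)| ≤ 2 * (2 * s * (2 * s * (3 * s))) := by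
      rw [abs_mul, abs_mul, abs_of_pos hy0, abs_of_pos (by norm_num : (0 : ℝ) < 2)]
      gcongr
    have h2 : |(sqn y + 1) * (y - x) (Fin.last m)| ≤ (5 * s ^ 2) * (3 * s) := by
      rw [abs_mul, abs_of_nonneg (by linarith : 0 ≤ sqn y + 1)]
      gcongr
      · linarith
      · exact (abs_coord_le _ _).trans hyx
    refine (abs_sub _ _).trans ?_
    calc _ ≤ 2 * (2 * s * (2 * s * (3 * s))) + (5 * s ^ 2) * (3 * s) := add_le_add h1 h2
      _ = 39 * s ^ 3 := by ring
  have hX : |confDeriv (oddBump 4 (s ^ 2) x) y| ≤ 8 * (39 * s ^ 3 * (24 * ξ * s ^ 5)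
      + 2 * ξ * (13 * s ^ 2) * s ^ 6) := by
    rw [show oddBump 4 (s ^ 2) x = oddBump (2 + 2) (s ^ 2) x from rfl, confDeriv_oddBump, abs_mul]
    have : |(-2 * (((2 : ℕ) : ℝ) + 2))| = 8 := by push_cast; rw [abs_of_neg] <;> norm_num
    rw [this]
    refine mul_le_mul_of_nonneg_left ((abs_sub _ _).trans (add_le_add ?_ ?_)) (by norm_num)
    · rw [abs_mul, abs_of_nonneg p3]
      gcongr
    · rw [abs_mul, abs_mul, abs_of_nonneg pb3, abs_of_pos (by positivity : 0 < 2 * ξ)]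
      gcongr
  have hY : |(m + 3) * (y (Fin.last m) * oddBump 4 (s ^ 2) x y)|
      ≤ (m + 3) * (2 * s * (32 * ξ * s ^ 7)) := by
    rw [abs_of_nonneg (by positivity)]; gcongr
  have hZ : |(m + 1) * oddBump 4 (s ^ 2) x y| ≤ (m + 1) * (s * (32 * ξ * s ^ 7)) := by
    rw [abs_of_nonneg (by positivity)]
    gcongr
    refine h4.trans (le_mul_of_one_le_left (by positivity) hs)
  have htri : |adjKernel x (s ^ 2) y| ≤ |confDeriv (oddBump 4 (s ^ 2) x) y|
      + |(m + 3) * (y (Fin.last m) * oddBump 4 (s ^ 2) x y)|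
      + |(m + 1) * oddBump 4 (s ^ 2) x y| := by
    refine (abs_sub _ _).trans (add_le_add_left ((abs_sub _ _).trans ?_) _)
    rw [abs_neg]
  have hP : 0 ≤ ξ * s ^ 8 := by positivity
  have hmP : 0 ≤ m * (ξ * s ^ 8) := by positivity
  calc _ ≤ _ := htri
    _ ≤ _ := add_le_add (add_le_add hX hY) hZ
    _ = (7920 + 96 * m) * (ξ * s ^ 8) := by ring
    _ ≤ (8000 + 200 * m) * ξ * s ^ 8 := by nlinarith

/-- Dominated convergence on a fixed ball, with bound 1 and pointwise limit 0 off the origin. No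
comparison of `α` with the dimension is needed. -/
lemma tendsto_integral_decay {α : ℝ} (hα : 0 < α) :
    Tendsto (fun s : ℝ => ∫ z in Metric.closedBall (0 : Space m) 2, (1 + s * ‖z‖) ^ (-α))
      atTop (𝓝 0) := by
  have h0 : ∫ z in Metric.closedBall (0 : Space m) 2, (0 : ℝ) = 0 := by simp
  rw [← h0]
  have hfin : IsFiniteMeasure (volume.restrict (Metric.closedBall (0 : Space m) 2)) :=
    ⟨by simpa using measure_closedBall_lt_top⟩
  refine tendsto_integral_filter_of_dominated_convergence (fun _ => 1) ?_ ?_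
    (integrable_const _) ?_
  · filter_upwards [eventually_ge_atTop 0] with s hs
    refine Continuous.aestronglyMeasurable ?_
    exact (continuous_const.add (continuous_const.mul continuous_norm)).rpow_const
      fun z => Or.inl (show (1 + s * ‖z‖ : ℝ) ≠ 0 by positivity)
  · filter_upwards [eventually_ge_atTop 0] with s hs
    refine Eventually.of_forall fun z => ?_
    have h1 : 1 ≤ 1 + s * ‖z‖ := by
      have : 0 ≤ s * ‖z‖ := by positivity
      linarith
    rw [Real.norm_of_nonneg (by positivity)]
    exact Real.rpow_le_one_of_one_le_of_nonpos h1 (by linarith)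
  · refine ae_restrict_of_ae ?_
    filter_upwards [compl_mem_ae_iff.2 (measure_singleton (0 : Space m))] with z hz
    have hz0 : 0 < ‖z‖ := norm_pos_iff.2 hz
    exact (tendsto_rpow_neg_atTop hα).comp
      (tendsto_atTop_add_const_left _ _ (tendsto_id.atTop_mul_const hz0))

/-- The mass of a decaying function on large balls is of lower order than the volume. -/
lemma integral_abs_le_of_decay (hc : ContinuousOn ψ (closedHalf m)) {α C : ℝ}
    (hdec : ∀ y ∈ closedHalf m, |ψ y| ≤ C * (1 + ‖y‖) ^ (-α)) {s : ℝ} (hs : 0 < s) :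
    ∫ y in openHalf m ∩ Metric.closedBall 0 (2 * s), |ψ y|
      ≤ s ^ (m + 1) * (C * ∫ z in Metric.closedBall (0 : Space m) 2, (1 + s * ‖z‖) ^ (-α)) := by
  have hC : 0 ≤ C := by
    have := hdec 0 (by simp [closedHalf])
    simp at this
    exact (abs_nonneg _).trans this
  have hcont : Continuous fun y : Space m => C * (1 + ‖y‖) ^ (-α) :=
    continuous_const.mul ((continuous_const.add continuous_norm).rpow_const
      fun z => Or.inl (show (1 + ‖z‖ : ℝ) ≠ 0 by positivity))
  have hint : IntegrableOn (fun y : Space m => C * (1 + ‖y‖) ^ (-α))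
      (Metric.closedBall 0 (2 * s)) :=
    hcont.continuousOn.integrableOn_compact (isCompact_closedBall _ _)
  have hint2 : IntegrableOn (fun y => |ψ y|) (openHalf m ∩ Metric.closedBall 0 (2 * s)) := by
    have : IntegrableOn (fun y => |ψ y|) (closedHalf m ∩ Metric.closedBall 0 (2 * s)) :=
      (hc.abs.mono inter_subset_left).integrableOn_compact
        ((isCompact_closedBall _ _).inter_left isClosed_closedHalf)
    exact this.mono_set (inter_subset_inter_left _ openHalf_subset)
  have h1 : ∫ y in openHalf m ∩ Metric.closedBall 0 (2 * s), |ψ y|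
      ≤ ∫ y in Metric.closedBall (0 : Space m) (2 * s), C * (1 + ‖y‖) ^ (-α) := by
    refine (setIntegral_mono_on hint2 (hint.mono_set inter_subset_right)
      (measurableSet_openHalf.inter Metric.isClosed_closedBall.measurableSet)
      fun y hy => hdec y (openHalf_subset hy.1)).trans ?_
    exact setIntegral_mono_set hint
      (Eventually.of_forall fun y => by simp only [Pi.zero_apply]; positivity)
      inter_subset_right.eventuallyLE
  refine h1.trans_eq ?_
  -- The substitution `y = s z` produces the factor `s^{m+1}`.
  have h2 := Measure.setIntegral_comp_smul_of_pos volume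
    (fun y : Space m => C * (1 + ‖y‖) ^ (-α)) (Metric.closedBall (0 : Space m) 2) hs
  have hball : s • Metric.closedBall (0 : Space m) 2 = Metric.closedBall 0 (2 * s) := by
    rw [smul_closedBall _ _ (by norm_num), smul_zero, Real.norm_of_nonneg hs.le, mul_comm]
  rw [hball, finrank_euclideanSpace_fin] at h2
  simp only [norm_smul, Real.norm_of_nonneg hs.le, integral_const_mul, smul_eq_mul] at h2
  rw [integral_const_mul, h2]
  field_simp

lemma IsLinearizedSolution.pairing_eq_zero (hψ : IsLinearizedSolution m ψ) (hm : 2 ≤ m)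
    {α C : ℝ} (hα : 0 < α) (hdec : ∀ y ∈ closedHalf m, |ψ y| ≤ C * (1 + ‖y‖) ^ (-α))
    {x : Space m} (hx : x ∈ openHalf m) {s : ℝ} (hs : 0 < s) : pairing ψ 4 x (s ^ 2) = 0 := by
  obtain ⟨c, hc⟩ := hψ.pairing_homogeneous hm x
  suffices hc0 : c = 0 by rw [hc s hs, hc0, zero_mul]
  set K : ℝ := (8000 + 200 * m) * x (Fin.last m)
  have hx0 : 0 < x (Fin.last m) := hx
  have hK : 0 ≤ K := by positivity
  have hlim : Tendsto (fun s : ℝ => K * (C *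
      ∫ z in Metric.closedBall (0 : Space m) 2, (1 + s * ‖z‖) ^ (-α))) atTop (𝓝 0) := by
    simpa using ((tendsto_integral_decay (m := m) hα).const_mul C).const_mul K
  -- The kernel contributes `s^8` and the mass of `ψ` contributes `s^{m+1}` times a null sequence,
  -- which matches the exponent `m + 9` exactly.
  have hev : ∀ᶠ s : ℝ in atTop, |c| ≤ K * (C *
      ∫ z in Metric.closedBall (0 : Space m) 2, (1 + s * ‖z‖) ^ (-α)) := by
    filter_upwards [eventually_ge_atTop 1, eventually_ge_atTop (‖x‖ + ‖refl x‖)] with s hs1 hsx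
    have hs0 : 0 < s := by linarith
    have hψc := hψ.contDiffOn.continuousOn
    have hsubz : ∫ y in openHalf m, ψ y * adjKernel x (s ^ 2) y
        = ∫ y in openHalf m ∩ Metric.closedBall 0 (2 * s), ψ y * adjKernel x (s ^ 2) y := by
      refine setIntegral_eq_of_subset_of_forall_sdiff_eq_zero measurableSet_openHalf
        inter_subset_left ?_
      rintro y ⟨hy, hy'⟩
      rw [adjKernel_eq_zero hs0.le, mul_zero]
      by_contra! h
      exact hy' ⟨hy, by simp; linarith⟩
    have hI : IntegrableOn (fun y => s ^ 8 * K * |ψ y|)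
        (openHalf m ∩ Metric.closedBall 0 (2 * s)) := by
      have : IntegrableOn (fun y => s ^ 8 * K * |ψ y|)
          (closedHalf m ∩ Metric.closedBall 0 (2 * s)) :=
        (continuousOn_const.mul (hψc.abs.mono inter_subset_left)).integrableOn_compact
          ((isCompact_closedBall _ _).inter_left isClosed_closedHalf)
      exact this.mono_set (inter_subset_inter_left _ openHalf_subset)
    have hle : |pairing ψ 4 x (s ^ 2)| ≤ s ^ 8 * K *
        ∫ y in openHalf m ∩ Metric.closedBall 0 (2 * s), |ψ y| := by
      rw [hψ.pairing_eq x hs0.le, hsubz, ← integral_const_mul, ← Real.norm_eq_abs]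
      refine norm_integral_le_of_norm_le hI ?_
      refine (ae_restrict_iff' (measurableSet_openHalf.inter
        Metric.isClosed_closedBall.measurableSet)).2 (Eventually.of_forall fun y hy => ?_)
      have h1 := abs_adjKernel_le hx hy.1 hs1 (by linarith [norm_nonneg (refl x)])
        (by simpa using hy.2)
      rw [Real.norm_eq_abs, abs_mul]
      calc |ψ y| * |adjKernel x (s ^ 2) y| ≤ |ψ y| * (K * s ^ 8) := by gcongr
        _ = s ^ 8 * K * |ψ y| := by ring
    have hle2 := hle.trans (mul_le_mul_of_nonneg_left
      (integral_abs_le_of_decay hψc hdec hs0) (by positivity))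
    rw [hc s hs0, abs_mul, abs_of_pos (by positivity : 0 < s ^ (m + 9))] at hle2
    refine le_of_mul_le_mul_right (hle2.trans_eq ?_) (by positivity : 0 < s ^ (m + 9))
    ring
  have := ge_of_tendsto hlim hev
  exact abs_nonpos_iff.1 this

/-- A decaying solution satisfies the first-order equation. -/
theorem IsLinearizedSolution.defect_eq_zero (hψ : IsLinearizedSolution m ψ) (hm : 2 ≤ m)
    {α C : ℝ} (hα : 0 < α) (hdec : ∀ y ∈ closedHalf m, |ψ y| ≤ C * (1 + ‖y‖) ^ (-α))
    {x : Space m} (hx : x ∈ openHalf m) : defect ψ x = 0 := by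
  by_contra hne
  have hx0 : 0 < x (Fin.last m) := hx
  -- Multiplying by the constant `defect ψ x` treats both signs at once.
  have hcont : ContinuousOn (fun y => defect ψ x * defect ψ y) (openHalf m) :=
    continuousOn_const.mul (hψ.continuousOn_defect.mono openHalf_subset)
  have hpos : 0 < defect ψ x * defect ψ x := mul_self_pos.2 hne
  have hmem : {y | y ∈ openHalf m ∧ 0 < defect ψ x * defect ψ y} ∈ 𝓝 x :=
    inter_mem (isOpen_openHalf.mem_nhds hx)
      ((hcont.continuousAt (isOpen_openHalf.mem_nhds hx)).eventually (lt_mem_nhds hpos))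
  obtain ⟨r, hr, hball⟩ := Metric.mem_nhds_iff.1 hmem
  -- The bound `s ≤ r` keeps the bump where the product is positive; `s ≤ x_n` makes the reflected
  -- bump vanish on the half-space.
  set s := min r (x (Fin.last m)) with hs
  have hs0 : 0 < s := lt_min hr hx0
  have hrefl (y : Space m) (hy : y ∈ openHalf m) : bump 4 (s ^ 2) (refl x) y = 0 := by
    have hy0 : 0 < y (Fin.last m) := hy
    refine truncPow_of_nonpos ?_
    have h1 : (y (Fin.last m) - x (Fin.last m)) ^ 2 ≤ sqn (y - x) := by
      have := Finset.single_le_sum (f := fun a => (y - x) a ^ 2) (fun a _ => sq_nonneg _)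
        (Finset.mem_univ (Fin.last m))
      simpa [sqn] using this
    rw [sqn_sub_refl]
    have h2 : s ≤ x (Fin.last m) := min_le_right _ _
    nlinarith [mul_pos hx0 hy0]
  have hint := hψ.integrableOn_oddBump 3 x hs0.le
  have hzero : ∫ y in openHalf m, defect ψ x * (defect ψ y * oddBump 4 (s ^ 2) x y) = 0 := by
    rw [integral_const_mul]
    have := hψ.pairing_eq_zero hm hα hdec hx hs0
    rw [pairing] at this
    rw [this, mul_zero]
  have hnn : 0 ≤ᵐ[volume.restrict (openHalf m)]
      fun y => defect ψ x * (defect ψ y * oddBump 4 (s ^ 2) x y) := by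
    refine (ae_restrict_iff' measurableSet_openHalf).2 (Eventually.of_forall fun y hy => ?_)
    simp only [Pi.zero_apply]
    rw [← mul_assoc]
    by_cases hyr : ‖y - x‖ < r
    · exact mul_nonneg (hball (by simpa [dist_eq_norm] using hyr)).2.le
        (oddBump_nonneg 4 _ hx hy)
    · have : bump 4 (s ^ 2) x y = 0 := by
        refine truncPow_of_nonpos ?_
        rw [sqn_eq_norm]
        have h2 : s ≤ ‖y - x‖ := (min_le_left _ _).trans (not_lt.1 hyr)
        nlinarith
      rw [oddBump, this, hrefl y hy]
      simp
  have hae := (setIntegral_eq_zero_iff_of_nonneg_ae hnn (hint.const_mul _)).1 hzero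
  have heq := Measure.eqOn_open_of_ae_eq hae isOpen_openHalf
    (continuousOn_const.mul ((hψ.continuousOn_defect.mono openHalf_subset).mul
      (continuous_oddBump _ _ _).continuousOn)) continuousOn_const
  have hfin := heq hx
  have hb : bump 4 (s ^ 2) x x = (s ^ 2) ^ 4 := by
    simp [bump, sqn, truncPow, sq_nonneg]
  simp only [Pi.zero_apply, oddBump, hrefl x hx, hb, sub_zero] at hfin
  rw [← mul_assoc] at hfin
  exact (mul_pos hpos (by positivity)).ne' hfin

end vanishing

end HalfSpace

/-! ### Integration of the first-order equation by inversion. -/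

namespace HalfSpace

open Set Filter Topology

section firstOrder

variable {m : ℕ} {ψ : Space m → ℝ}

lemma fderiv_apply_eq_sum (f : Space m → ℝ) (y v : Space m) :
    fderiv ℝ f y v = ∑ a, v a * pd a f y := by
  have hv : v = ∑ a, v a • e m a := by
    ext b
    simp [e_apply]
  conv_lhs => rw [hv]
  simp [pd]

/-- The quantity `|y + e_n|²`. -/
noncomputable def shiftSqn (y : Space m) : ℝ := sqn y + 2 * y (Fin.last m) + 1

lemma shiftSqn_pos {y : Space m} (hy : y ∈ closedHalf m) : 0 < shiftSqn y := by
  have hy0 : 0 ≤ y (Fin.last m) := hy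
  have := sqn_nonneg y
  unfold shiftSqn; linarith

lemma sqn_add_e (y : Space m) : sqn (y + e m (Fin.last m)) = shiftSqn y := by
  simp only [shiftSqn, sqn, Fin.sum_univ_castSucc]
  simp [e_apply, Fin.castSucc_ne_last]
  ring

lemma sqn_sub_smul_e (y : Space m) (r : ℝ) :
    sqn (y - r • e m (Fin.last m)) = sqn y - 2 * r * y (Fin.last m) + r ^ 2 := by
  simp only [sqn, Fin.sum_univ_castSucc]
  simp [e_apply, Fin.castSucc_ne_last]
  ring

lemma sqn_smul (c : ℝ) (y : Space m) : sqn (c • y) = c ^ 2 * sqn y := by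
  simp [sqn, mul_pow, Finset.mul_sum]

/-- The inversion mapping the ball of radius `1/2` about `e_n/2` to the half-space. -/
noncomputable def inv (b : Space m) : Space m := (sqn b)⁻¹ • b - e m (Fin.last m)

/-- The ball condition expands to `|b|² < b_n`, which says that `b_n / |b|² > 1`. -/
lemma inv_mem_openHalf {b : Space m} (hb : sqn (b - (1 / 2 : ℝ) • e m (Fin.last m)) < 1 / 4) :
    0 < sqn b ∧ inv b ∈ openHalf m := by
  rw [sqn_sub_smul_e] at hb
  have h0 := sqn_nonneg b
  have hpos : 0 < sqn b := by
    refine lt_of_le_of_ne h0 fun h => ?_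
    rw [← h] at hb
    have hsum := Finset.single_le_sum (f := fun a => b a ^ 2) (fun a _ => sq_nonneg _)
        (Finset.mem_univ (Fin.last m))
    have : b (Fin.last m) ^ 2 ≤ 0 := by
      have h2 : ∑ a, b a ^ 2 = 0 := h.symm
      exact hsum.trans_eq h2
    have : b (Fin.last m) = 0 := by nlinarith
    rw [this] at hb; norm_num at hb
  refine ⟨hpos, ?_⟩
  have : 1 < (sqn b)⁻¹ * b (Fin.last m) := by
    rw [inv_mul_eq_div, lt_div_iff₀ hpos]; linarith
  simpa [inv, openHalf, e_apply] using this

/-- The Kelvin transform of `ψ`. -/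
noncomputable def kelvin (ψ : Space m → ℝ) (b : Space m) : ℝ :=
  sqn b ^ (-((m - 1 : ℝ) / 2)) * ψ (inv b)

lemma differentiable_sqn : Differentiable ℝ (sqn (m := m)) :=
  (contDiff_sqn (k := 1)).differentiable (by simp)

lemma differentiableAt_kelvin (hd : ∀ y ∈ openHalf m, DifferentiableAt ℝ ψ y) {b : Space m}
    (hb : sqn (b - (1 / 2 : ℝ) • e m (Fin.last m)) < 1 / 4) :
    DifferentiableAt ℝ (kelvin ψ) b := by
  obtain ⟨h0, h1⟩ := inv_mem_openHalf hb
  have hs := differentiable_sqn b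
  have hi : DifferentiableAt ℝ (inv (m := m)) b :=
    ((hs.inv h0.ne').smul differentiableAt_id).sub_const _
  exact (hs.rpow_const (Or.inl h0.ne')).mul ((hd _ h1).comp b hi)

/-- The first-order equation says that the Kelvin transform is homogeneous of degree one about
the centre of the ball. -/
lemma hasDerivAt_kelvin (hd : ∀ y ∈ openHalf m, DifferentiableAt ℝ ψ y)
    (h0 : ∀ y ∈ openHalf m, defect ψ y = 0) (v : Space m) {t : ℝ} (ht : 0 < t)
    (htv : sqn (t • v) < 1 / 4) :
    HasDerivAt (fun t : ℝ => kelvin ψ ((1 / 2 : ℝ) • e m (Fin.last m) + t • v))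
      (t⁻¹ * kelvin ψ ((1 / 2 : ℝ) • e m (Fin.last m) + t • v)) t := by
  set b : ℝ → Space m := fun t => (1 / 2 : ℝ) • e m (Fin.last m) + t • v with hb
  have hbt : sqn (b t - (1 / 2 : ℝ) • e m (Fin.last m)) < 1 / 4 := by simpa [hb] using htv
  obtain ⟨hN, hy⟩ := inv_mem_openHalf hbt
  have hbd : HasDerivAt b v t := by
    have h := ((hasDerivAt_id t).smul_const v).const_add ((1 / 2 : ℝ) • e m (Fin.last m))
    rw [one_smul] at h
    exact h
  set N' : ℝ := ∑ a, v a * (2 * b t a) with hN'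
  have hNd : HasDerivAt (fun t => sqn (b t)) N' t := by
    have := (differentiable_sqn (b t)).hasFDerivAt.comp_hasDerivAt t hbd
    rw [fderiv_apply_eq_sum] at this
    simp only [pd_sqn] at this
    exact this
  have hid : HasDerivAt (fun t => inv (b t))
      ((sqn (b t))⁻¹ • v + (-N' / sqn (b t) ^ 2) • b t) t :=
    ((hNd.inv hN.ne').smul hbd).sub_const _
  have hψd := (hd _ hy).hasFDerivAt.comp_hasDerivAt t hid
  have hP := hNd.rpow_const (p := -((m - 1 : ℝ) / 2)) (Or.inl hN.ne')
  refine HasDerivAt.congr_deriv (hP.mul hψd) ?_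
  have hbn : b t (Fin.last m) = 1 / 2 + t * v (Fin.last m) := by simp [hb, e_apply]
  have htN : t * N' = 2 * sqn (b t) - b t (Fin.last m) := by
    have h1 (a) : t * v a = b t a - (if a = Fin.last m then 1 / 2 else 0) := by
      simp [hb, e_apply]
    have : t * N' = ∑ a, (t * v a) * (2 * b t a) := by
      rw [hN', Finset.mul_sum]; exact Finset.sum_congr rfl fun a _ => by ring
    rw [this]
    simp only [h1, sub_mul, Finset.sum_sub_distrib]
    have h2 : ∑ a, b t a * (2 * b t a) = 2 * sqn (b t) := by
      rw [sqn, Finset.mul_sum]; exact Finset.sum_congr rfl fun a _ => by ring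
    rw [h2]; simp
  set N := sqn (b t) with hNdef
  have hyn : inv (b t) (Fin.last m) = N⁻¹ * b t (Fin.last m) - 1 := by simp [inv, e_apply, hNdef]
  have hsy : sqn (inv (b t)) = N⁻¹ - 2 * (N⁻¹ * b t (Fin.last m)) + 1 := by
    have := sqn_sub_smul_e (N⁻¹ • b t) 1
    rw [one_smul, sqn_smul] at this
    rw [inv, ← hNdef, this, ← hNdef]
    simp
    field_simp
  -- The inversion carries twice the radial field about the centre to `X`.
  have hvel (a) : 2 * t * (N⁻¹ • v + (-N' / N ^ 2) • b t) a = confField a (inv (b t)) := by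
    have h1 : t * v a = b t a - (if a = Fin.last m then 1 / 2 else 0) := by
      simp [hb, e_apply]
    have h2 : inv (b t) a = N⁻¹ * b t a - (if a = Fin.last m then 1 else 0) := by
      simp [inv, e_apply, hNdef]
    have h3 : 2 * t * (N⁻¹ • v + (-N' / N ^ 2) • b t) a
        = 2 * (t * v a) / N - 2 * (t * N') * b t a / N ^ 2 := by
      simp; field_simp; ring
    rw [h3, h1, htN, confField, hyn, hsy, h2]
    split_ifs <;> field_simp <;> ring
  have hode : 2 * t * fderiv ℝ ψ (inv (b t)) (N⁻¹ • v + (-N' / N ^ 2) • b t)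
      = ((m + 1) - (m - 1 : ℝ) * inv (b t) (Fin.last m)) * ψ (inv (b t)) := by
    rw [fderiv_apply_eq_sum, Finset.mul_sum]
    have h1 := h0 _ hy
    rw [defect] at h1
    have h2 : ∑ a, 2 * t * ((N⁻¹ • v + (-N' / N ^ 2) • b t) a * pd a ψ (inv (b t)))
        = ∑ a, confField a (inv (b t)) * pdWithin a ψ (inv (b t)) :=
      Finset.sum_congr rfl fun a _ => by rw [← mul_assoc, hvel, pdWithin_eq hy]
    rw [h2]; linarith
  have hpow : N ^ (-((m - 1 : ℝ) / 2) - 1) = N ^ (-((m - 1 : ℝ) / 2)) * N⁻¹ := by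
    rw [Real.rpow_sub hN, Real.rpow_one, div_eq_mul_inv]
  rw [hyn] at hode
  rw [hpow, kelvin, ← hNdef]
  refine mul_left_cancel₀ (mul_ne_zero two_ne_zero ht.ne') ?_
  have e1 : 2 * t * (t⁻¹ * (N ^ (-((m - 1 : ℝ) / 2)) * ψ (inv (b t))))
      = 2 * (N ^ (-((m - 1 : ℝ) / 2)) * ψ (inv (b t))) := by field_simp
  have e2 : N * N⁻¹ = 1 := mul_inv_cancel₀ hN.ne'
  rw [e1]
  -- Under `2 t d/dt`, `ψ` contributes the factor `n - (n-2) y_n` and the Kelvin weight contributes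
  -- `-(n-2)(1 - y_n)`; their sum is 2, which is degree one.
  linear_combination (N ^ (-((m - 1 : ℝ) / 2))) * hode
    - (m - 1 : ℝ) * N⁻¹ * N ^ (-((m - 1 : ℝ) / 2)) * ψ (inv (b t)) * htN
    - 2 * (m - 1 : ℝ) * N ^ (-((m - 1 : ℝ) / 2)) * ψ (inv (b t)) * e2

/-- A function homogeneous of degree one about a point and differentiable there coincides with its
differential. The centre corresponds to the interior point `e_n`, so differentiability is available.
-/
lemma kelvin_eq_fderiv (hd : ∀ y ∈ openHalf m, DifferentiableAt ℝ ψ y)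
    (h0 : ∀ y ∈ openHalf m, defect ψ y = 0) {v : Space m} (hv : sqn v < 1 / 4) :
    kelvin ψ ((1 / 2 : ℝ) • e m (Fin.last m) + v)
      = fderiv ℝ (kelvin ψ) ((1 / 2 : ℝ) • e m (Fin.last m)) v := by
  set c : Space m := (1 / 2 : ℝ) • e m (Fin.last m) with hc
  set f : ℝ → ℝ := fun t => kelvin ψ (c + t • v) with hf
  have hsq (t : ℝ) (ht : t ∈ Icc (0 : ℝ) 1) : sqn (t • v) < 1 / 4 := by
    rw [sqn_smul]
    have := sqn_nonneg v
    have h2 : t ^ 2 ≤ 1 := by nlinarith [ht.1, ht.2]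
    nlinarith
  have hcont : ContinuousOn f (Icc 0 1) := fun t ht => by
    have h1 : DifferentiableAt ℝ (kelvin ψ) (c + t • v) :=
      differentiableAt_kelvin hd (by simpa [hc] using hsq t ht)
    have h2 : ContinuousAt (fun t : ℝ => c + t • v) t := by fun_prop
    exact (ContinuousAt.comp (f := fun t : ℝ => c + t • v) h1.continuousAt h2).continuousWithinAt
  have hder (t : ℝ) (ht : t ∈ Ioc (0 : ℝ) 1) : HasDerivAt f (t⁻¹ * f t) t :=
    hasDerivAt_kelvin hd h0 v ht.1 (hsq t ⟨ht.1.le, ht.2⟩)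
  have hlin : EqOn f (fun t => t * f 1) (Ioc 0 1) := by
    have hq : ∀ t ∈ Ioc (0 : ℝ) 1, HasDerivAt (fun t => f t / t) 0 t := fun t ht => by
      refine ((hder t ht).div (hasDerivAt_id t) ht.1.ne').congr_deriv ?_
      have := ht.1.ne'
      simp only [id]
      field_simp; ring
    have hconst : ∀ t ∈ Ioc (0 : ℝ) 1, f t / t = f 1 / 1 := fun t ht =>
      (convex_Ioc (0 : ℝ) 1).is_const_of_fderivWithin_eq_zero
        (fun u hu => (hq u hu).differentiableAt.differentiableWithinAt)
        (fun u hu => by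
          have hu' : UniqueDiffWithinAt ℝ (Ioc (0 : ℝ) 1) u := uniqueDiffOn_Ioc 0 1 u hu
          rw [(hq u hu).hasFDerivAt.hasFDerivWithinAt.fderivWithin hu']
          ext; simp) ht ⟨one_pos, le_rfl⟩
    intro t ht
    have := hconst t ht
    rw [div_one, div_eq_iff ht.1.ne'] at this
    simp only [this, mul_comm]
  -- Continuity extends linearity to `t = 0`, where the slope `f 1` can be compared with the
  -- differential.
  have hlin' : EqOn f (fun t => t * f 1) (Icc 0 1) :=
    hlin.of_subset_closure hcont (continuous_id.mul continuous_const).continuousOn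
      Ioc_subset_Icc_self (by rw [closure_Ioc (by norm_num)])
  have h00 : (0 : ℝ) ∈ Icc (0 : ℝ) 1 := ⟨le_rfl, zero_le_one⟩
  have hfd : HasDerivAt f (fderiv ℝ (kelvin ψ) c v) 0 := by
    have h1 : DifferentiableAt ℝ (kelvin ψ) (c + (0 : ℝ) • v) :=
      differentiableAt_kelvin hd (by simpa [hc] using hsq 0 h00)
    have h2 : HasDerivAt (fun t : ℝ => c + t • v) v 0 := by
      simpa using ((hasDerivAt_id (0 : ℝ)).smul_const v).const_add c
    have h3 := h1.hasFDerivAt.comp_hasDerivAt (0 : ℝ) h2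
    rw [zero_smul, add_zero] at h3
    exact h3
  have hfl : HasDerivWithinAt (fun t => t * f 1) (f 1) (Icc 0 1) 0 := by
    simpa using ((hasDerivAt_id (0 : ℝ)).mul_const (f 1)).hasDerivWithinAt
  have huniq := (uniqueDiffOn_Icc (zero_lt_one (α := ℝ)) 0 h00).eq_deriv _
    (hfd.hasDerivWithinAt (s := Icc 0 1))
    (hfl.congr (fun t ht => hlin' ht) (hlin' h00))
  rw [huniq, hf]
  simp

/-- Solutions of the first-order equation form an `n`-dimensional explicit family. -/
lemma eq_of_defect_eq_zero (hd : ∀ y ∈ openHalf m, DifferentiableAt ℝ ψ y)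
    (h0 : ∀ y ∈ openHalf m, defect ψ y = 0) :
    ∃ l : Fin (m + 1) → ℝ, ∀ y ∈ openHalf m,
      ψ y = shiftSqn y ^ (-((m - 1 : ℝ) / 2) - 1)
        * ∑ a, (if a = Fin.last m then (1 - sqn y) / 2 else y a) * l a := by
  set c : Space m := (1 / 2 : ℝ) • e m (Fin.last m) with hc
  refine ⟨fun a => pd a (kelvin ψ) c, fun y hy => ?_⟩
  have hD := shiftSqn_pos (openHalf_subset hy)
  have hy0 : 0 < y (Fin.last m) := hy
  set D := shiftSqn y with hDdef
  set b : Space m := D⁻¹ • (y + e m (Fin.last m)) with hb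
  have hsb : sqn b = D⁻¹ := by
    rw [hb, sqn_smul, sqn_add_e, ← hDdef]; field_simp
  have hinv : inv b = y := by
    rw [inv, hsb, hb, smul_smul, inv_inv, mul_inv_cancel₀ hD.ne', one_smul, add_sub_cancel_right]
  have hv : sqn (b - c) < 1 / 4 := by
    rw [hc, sqn_sub_smul_e, hsb]
    have : b (Fin.last m) = D⁻¹ * (y (Fin.last m) + 1) := by simp [hb, e_apply, mul_add]
    rw [this]
    have : 0 < D⁻¹ * y (Fin.last m) := by positivity
    nlinarith
  have hk := kelvin_eq_fderiv hd h0 hv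
  rw [add_sub_cancel, fderiv_apply_eq_sum, kelvin, hinv, hsb, Real.inv_rpow hD.le,
    ← Real.rpow_neg hD.le, neg_neg] at hk
  -- The linear coordinates about the centre, read in the half-space; the last one uses `2(y_n + 1)
  -- - |y + e_n|² = 1 - |y|²`.
  have hcoord (a) : (b - c) a
      = D⁻¹ * (if a = Fin.last m then (1 - sqn y) / 2 else y a) := by
    have : sqn y = D - 2 * y (Fin.last m) - 1 := by rw [hDdef, shiftSqn]; ring
    by_cases h : a = Fin.last m
    · subst h
      simp [hb, hc, e_apply, this]; field_simp; ring
    · simp [hb, hc, e_apply, h]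
  simp only [hcoord, mul_assoc, ← Finset.mul_sum] at hk
  rw [Real.rpow_sub hD, Real.rpow_one, Real.rpow_neg hD.le, div_mul_eq_mul_div, mul_div_assoc,
    div_eq_inv_mul _ D, ← hk, inv_mul_cancel_left₀ (by positivity)]

/-! ### Explicit formulas for the `J_a` and passage to the boundary. -/

lemma U_eq (y : Space m) : U m y = shiftSqn y ^ (-((m - 1 : ℝ) / 2)) := by
  have h1 : (∑ j : Fin m, y j.castSucc ^ 2) + (y (Fin.last m) + 1) ^ 2 = shiftSqn y := by
    simp only [shiftSqn, sqn, Fin.sum_univ_castSucc]; ring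
  rw [U, h1]
  congr 1; ring

lemma partialU_eq {y : Space m} (hy : y ∈ closedHalf m) (a : Fin (m + 1)) :
    partialU m a y = -(m - 1 : ℝ) * shiftSqn y ^ (-((m - 1 : ℝ) / 2) - 1)
      * (y a + if a = Fin.last m then 1 else 0) := by
  have hD := shiftSqn_pos hy
  have hU : U m = fun y => shiftSqn y ^ (-((m - 1 : ℝ) / 2)) := funext U_eq
  have h1 : DifferentiableAt ℝ (fun y : Space m => 2 * y (Fin.last m)) y :=
    (differentiable_coord _ y).const_mul 2
  have h2 : DifferentiableAt ℝ (shiftSqn (m := m)) y :=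
    ((differentiable_sqn y).add h1).add_const 1
  have h3 : pd a (shiftSqn (m := m)) y = 2 * (y a + if a = Fin.last m then 1 else 0) := by
    unfold shiftSqn
    rw [pd_add ((differentiable_sqn y).fun_add h1) (differentiableAt_const _),
      pd_add (differentiable_sqn y) h1, pd_sqn, pd_const_mul _ (differentiable_coord _ y),
      pd_coord, pd_const]
    simp only [eq_comm (a := a)]
    ring
  have h4 := h2.hasFDerivAt.rpow_const (p := -((m - 1 : ℝ) / 2)) (Or.inl hD.ne')
  have h5 : fderiv ℝ (shiftSqn (m := m)) y (e m a) = pd a shiftSqn y := rfl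
  rw [partialU, hU, h4.fderiv, smul_apply, h5, h3, smul_eq_mul]
  ring

lemma J_eq {y : Space m} (hy : y ∈ closedHalf m) (a : Fin (m + 1)) :
    J m a y = shiftSqn y ^ (-((m - 1 : ℝ) / 2) - 1) * (m - 1 : ℝ)
      * (if a = Fin.last m then (1 - sqn y) / 2 else -y a) := by
  have hD := shiftSqn_pos hy
  unfold J
  by_cases h : a = Fin.last m
  · simp only [h, if_true, partialU_eq hy, U_eq]
    have h1 : shiftSqn y ^ (-((m - 1 : ℝ) / 2))
        = shiftSqn y ^ (-((m - 1 : ℝ) / 2) - 1) * shiftSqn y := by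
      rw [Real.rpow_sub hD, Real.rpow_one]; field_simp
    have h2 : ∑ b, y b * (-(m - 1 : ℝ) * shiftSqn y ^ (-((m - 1 : ℝ) / 2) - 1)
        * (y b + if b = Fin.last m then 1 else 0))
        = -(m - 1 : ℝ) * shiftSqn y ^ (-((m - 1 : ℝ) / 2) - 1) * (sqn y + y (Fin.last m)) := by
      have h3 : y (Fin.last m) = ∑ b, y b * if b = Fin.last m then 1 else 0 := by simp
      rw [h3, sqn, ← Finset.sum_add_distrib, Finset.mul_sum]
      exact Finset.sum_congr rfl fun b _ => by ring
    rw [h2, h1]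
    -- The combination `|y + e_n|²/2 - |y|² - y_n` equals `(1 - |y|²)/2`.
    nth_rw 2 [shiftSqn]
    ring
  · simp only [h, if_false, partialU_eq hy]
    ring

lemma closedHalf_subset_closure : closedHalf m ⊆ closure (openHalf m) := by
  intro y hy
  have hy0 : 0 ≤ y (Fin.last m) := hy
  have h1 : Tendsto (fun t : ℝ => y + t • e m (Fin.last m)) (𝓝[>] 0) (𝓝 y) := by
    have : ContinuousAt (fun t : ℝ => y + t • e m (Fin.last m)) 0 := by fun_prop
    have h2 := this.tendsto
    simp only [zero_smul, add_zero] at h2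
    exact h2.mono_left nhdsWithin_le_nhds
  refine mem_closure_of_tendsto h1 ?_
  filter_upwards [self_mem_nhdsWithin] with t ht
  have ht0 : (0 : ℝ) < t := ht
  simp [openHalf, e_apply]
  linarith

end firstOrder

end HalfSpace

theorem lemma2p1 (m : ℕ) (hm : 3 ≤ m + 1) (ψ : HalfSpace.Space m → ℝ)
    (hψ : HalfSpace.IsLinearizedSolution m ψ)
    (hdecay : ∃ α : ℝ, 0 < α ∧ ∃ C : ℝ, ∀ y ∈ HalfSpace.closedHalf m,
      |ψ y| ≤ C * (1 + ‖y‖) ^ (-α)) :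
    ∃ c : Fin (m + 1) → ℝ, ∀ y ∈ HalfSpace.closedHalf m,
      ψ y = ∑ a : Fin (m + 1), c a * HalfSpace.J m a y := by
  open HalfSpace in
  obtain ⟨α, hα, C, hdec⟩ := hdecay
  have hm2 : 2 ≤ m := by omega
  have hm1 : (m - 1 : ℝ) ≠ 0 := by
    have : (2 : ℝ) ≤ m := by exact_mod_cast hm2
    linarith
  obtain ⟨l, hl⟩ := eq_of_defect_eq_zero (fun y hy => hψ.differentiableAt hy)
    (fun y hy => hψ.defect_eq_zero hm2 hα hdec hy)
  have hcont : ContinuousOn (fun y : Space m => shiftSqn y ^ (-((m - 1 : ℝ) / 2) - 1)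
      * ∑ a, (if a = Fin.last m then (1 - sqn y) / 2 else y a) * l a) (closedHalf m) := by
    have hs : Continuous (sqn (m := m)) := differentiable_sqn.continuous
    have hc (a) : Continuous (fun y : Space m => y a) := (differentiable_coord a).continuous
    have hD : Continuous (shiftSqn (m := m)) :=
      (hs.add (continuous_const.mul (hc _))).add continuous_const
    refine (hD.continuousOn.rpow_const fun y hy => Or.inl (shiftSqn_pos hy).ne').mul
      (Continuous.continuousOn (continuous_finsetSum _ fun a _ => Continuous.mul ?_
        continuous_const))
    by_cases h : a = Fin.last m
    · simp only [h, if_true]; exact (continuous_const.sub hs).div_const 2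
    · simp only [h, if_false]; exact hc a
  have heq := Set.EqOn.of_subset_closure (fun y hy => hl y hy) hψ.contDiffOn.continuousOn hcont
    openHalf_subset closedHalf_subset_closure
  -- The sign and the factor `n - 2` compensate those in `J_eq`; `n ≥ 3` makes the division
  -- legitimate.
  refine ⟨fun a => (if a = Fin.last m then l a else -l a) / (m - 1 : ℝ), fun y hy => ?_⟩
  refine (heq hy).trans ?_
  simp only [Finset.mul_sum]
  refine Finset.sum_congr rfl fun a _ => ?_
  rw [J_eq hy]
  split_ifs <;> field_simp
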